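/- Let $r_k(t)=\operatorname{sign}\sin(2^{k-1}\pi t)$, $k=1,2,\dots$, be the Rademacher functions on $[0,1]$, and let $\mathbf r_{i,j}$ $(1\le i<j<\infty)$ be pairwise distinct Rademacher functions, indexed in an arbitrary way by the pairs $(i,j)$. Let $X$ be a symmetric space on $[0,1]$, that is, a non-zero Banach space of (classes of) real measurable functions on $[0,1]$ such that (i) if $y\in X$, $x$ is measurable and $|x|\le|y|$ a.e., then $x\in X$ and $\|x\|_X\le\|y\|_X$; (ii) if $y\in X$ and $|x|,|y|$ are equimeasurable, then $x\in X$ and $\|x\|_X=\|y\|_X$. Let $G$ be the closure of $L_\infty$ in the Orlicz space $L_N$ on $[0,1]$ with $N(t)=e^{t^2}-1$. For a real array $a=(a_{i,j})_{1\le i<j<\infty}$ put $\|a\|_2=\big(\sum_{i<j}a_{i,j}^2\big)^{1/2}\in[0,\infty]$. Then the following assertions are equivalent: 1) $X\supset G$; 2) there is a constant $C>0$ such that for all $n$ and all real $a_{i,j}$ $(1\le i<j\le n)$ $$C^{-1}\Big(\sum_{1\le i<j\le n}a_{i,j}^2\Big)^{1/2}\le\int_0^1\Big\|\sum_{1\le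 i<j\le n}a_{i,j}\mathbf r_{i,j}(u)\,r_ir_j\Big\|_X\,du\le C\Big(\sum_{1\le i<j\le n}a_{i,j}^2\Big)^{1/2};$$ 2') there is a constant $C>0$ such that for every real array $a=(a_{i,j})_{1\le i<j<\infty}$ $$C^{-1}\|a\|_2\le\int_0^1\Big\|\sum_{1\le i<j<\infty}a_{i,j}\mathbf r_{i,j}(u)\,r_ir_j\Big\|_X\,du\le C\|a\|_2,$$ where the infinite sum is the limit in $X$ of the partial sums $\sum_{1\le i<j\le n}$ as $n\to\infty$, and its norm is taken to be $\infty$ for those $u$ for which this limit does not exist. (In particular, if $\|a\|_2<\infty$, the series converges in $X$ for almost every $u$.) -/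

import Mathlib

open MeasureTheory Filter Topology
open scoped ENNReal NNReal unitInterval

/-- Real measurable functions on `[0,1]` (Lebesgue measure), modulo equality almost everywhere. -/
abbrev MeasFun : Type := I →ₘ[(volume : Measure I)] ℝ

/-- `|x|` and `|y|` are equimeasurable: they have the same distribution function. -/
def AbsEquimeasurable (x y : MeasFun) : Prop :=
  ∀ τ : ℝ, 0 < τ →
    (volume : Measure I) {t | τ < |x t|} = (volume : Measure I) {t | τ < |y t|}

/-- A symmetric (rearrangement invariant) Banach function space `X ≠ {0}` on `[0,1]`.
It is given by its norm, extended by the value `∞` to the measurable functions outside `X`;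
thus `X = {x | ‖x‖_X < ∞}`. -/
structure SymmetricSpace where
  /-- The norm of `X`, with value `∞` outside `X`. -/
  norm : MeasFun → ℝ≥0∞
  norm_smul : ∀ (c : ℝ) (x : MeasFun), norm (c • x) = ENNReal.ofReal |c| * norm x
  norm_add_le : ∀ x y : MeasFun, norm (x + y) ≤ norm x + norm y
  eq_zero_of_norm_eq_zero : ∀ x : MeasFun, norm x = 0 → x = 0
  /-- Completeness of `X`. -/
  complete : ∀ f : ℕ → MeasFun, (∀ n, norm (f n) < ∞) →
    (∀ ε : ℝ≥0∞, 0 < ε → ∃ N, ∀ m ≥ N, ∀ n ≥ N, norm (f m - f n) < ε) →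
    ∃ x : MeasFun, norm x < ∞ ∧ Tendsto (fun n => norm (f n - x)) atTop (𝓝 0)
  /-- `|x| ≤ |y|` a.e. and `y ∈ X` imply `x ∈ X` and `‖x‖_X ≤ ‖y‖_X`. -/
  norm_mono : ∀ x y : MeasFun, (∀ᵐ t : I, |x t| ≤ |y t|) → norm x ≤ norm y
  /-- If `|x|`, `|y|` are equimeasurable and `y ∈ X`, then `x ∈ X` and `‖x‖_X = ‖y‖_X`. -/
  norm_eq_of_equimeasurable : ∀ x y : MeasFun, AbsEquimeasurable x y → norm x = norm y
  /-- `X ≠ {0}`. -/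
  nontrivial : ∃ x : MeasFun, x ≠ 0 ∧ norm x < ∞

/-- The set of functions that belong to `X`. -/
def SymmetricSpace.carrier (X : SymmetricSpace) : Set MeasFun := {x | X.norm x < ∞}

/-- The Luxemburg norm
`inf {l > 0 : ∫₀¹ A(|x(t)|/l) dt ≤ 1}` of the Orlicz space `L_A`, equal to `∞` outside `L_A`. -/
noncomputable def orliczNorm (A : ℝ → ℝ) (x : MeasFun) : ℝ≥0∞ :=
  sInf {c : ℝ≥0∞ | ∃ l : ℝ, 0 < l ∧ c = ENNReal.ofReal l ∧
    ∫⁻ t : I, ENNReal.ofReal (A (|x t| / l)) ≤ 1}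

/-- `G`: the closure of `L_∞` in the Orlicz space `L_N`, `N(t) = exp(t²) - 1`. -/
def spaceG : Set MeasFun :=
  {x | orliczNorm (fun s => Real.exp (s ^ 2) - 1) x < ∞ ∧
    ∀ ε : ℝ≥0∞, 0 < ε → ∃ y ∈ Lp ℝ ∞ (volume : Measure I),
      orliczNorm (fun s => Real.exp (s ^ 2) - 1) (x - y) < ε}

/-- The Rademacher functions `sign (sin (2 ^ k π t))`, indexed by `k = 0, 1, 2, …`
(the usual `r_{k+1}`). -/
noncomputable def rademacher (k : ℕ) (t : ℝ) : ℝ :=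
  Real.sign (Real.sin (2 ^ k * Real.pi * t))

theorem measurable_rademacher (k : ℕ) : Measurable (rademacher k) := by
  have hs : Measurable Real.sign := by
    unfold Real.sign
    exact Measurable.ite measurableSet_Iio measurable_const
      (Measurable.ite measurableSet_Ioi measurable_const measurable_const)
  exact hs.comp (by fun_prop)

/-- The element `r_i r_j` of the Rademacher chaos of order 2. -/
noncomputable def chaosFun (i j : ℕ) : MeasFun :=
  AEEqFun.mk (fun t : I => rademacher i t * rademacher j t)
    (((measurable_rademacher i).comp measurable_subtype_coe).mul
      ((measurable_rademacher j).comp measurable_subtype_coe)).aestronglyMeasurable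

/-- The randomized partial sum `∑_{i < j < n} a_{ij} 𝐫_{ij}(u) r_i r_j`, where `𝐫_{ij}` is the
Rademacher function with number `e i j`. -/
noncomputable def randomSum (e : ℕ → ℕ → ℕ) (a : ℕ → ℕ → ℝ) (n : ℕ) (u : I) : MeasFun :=
  ∑ j ∈ Finset.range n, ∑ i ∈ Finset.range j, (a i j * rademacher (e i j) u) • chaosFun i j

/-- The norm in `X` of the limit in `X` of the sequence `f`; it is `∞` if `f` does not
converge in `X`. -/
noncomputable def SymmetricSpace.limNorm (X : SymmetricSpace) (f : ℕ → MeasFun) : ℝ≥0∞ :=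
  ⨅ (x : MeasFun) (_ : Tendsto (fun n => X.norm (f n - x)) atTop (𝓝 0)), X.norm x

/-- `(∑_{i < j < n} a_{ij}²)^{1/2}`. -/
noncomputable def l2NormUpTo (a : ℕ → ℕ → ℝ) (n : ℕ) : ℝ≥0∞ :=
  (∑ j ∈ Finset.range n, ∑ i ∈ Finset.range j, ENNReal.ofReal (a i j ^ 2)) ^ (1 / 2 : ℝ)

/-- `‖(a_{ij})‖₂ = (∑_{i < j} a_{ij}²)^{1/2}`, possibly infinite. -/
noncomputable def l2Norm (a : ℕ → ℕ → ℝ) : ℝ≥0∞ :=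
  (∑' j, ∑ i ∈ Finset.range j, ENNReal.ofReal (a i j ^ 2)) ^ (1 / 2 : ℝ)

/-! For fixed `t` the factors `r_i(t) r_j(t)` are signs, so as a function of `u` the random chaos is
a Rademacher sum with coefficients `± a_{ij}`, whose squares do not depend on `t`. Its behaviour in
`u` is subgaussian at scale `‖a‖₂`, uniformly in `t`, and Fubini's theorem turns this into
information about the distribution in `t` for typical `u`.

Lower estimate, valid in every `X`: Paley–Zygmund makes the chaos at least of order `‖a‖₂` on a set
of `(u, t)` of measure bounded below, and `X` embeds in the measurable functions by a weak-type
inequality (`mul_volume_le_norm`).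

Upper estimate from `X ⊃ G`: the inclusion is automatically continuous
(`exists_norm_le_of_spaceG_subset`), and the exponential modular of the chaos at level `3‖a‖₂` has
`u`-average at most 1 (`lintegral_expModular_randomSum_le`).

Conversely, one row of coefficients 1 suffices. Up to signs that do not change the distribution of
the absolute value, the chaos is then `r_1 + … + r_K` with `K = 4 ^ J`. By `card_cube_tail` its
tails, at scale `2 ^ J`, are bounded below by Gaussian tails up to a height growing with `J`. Every
bounded function with `L_N`-norm at most 1 is therefore dominated in distribution by a fixed
multiple of the normalized sum plus a constant (`norm_le_of_tail_ge`). Thus `X` is controlled by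
`L_N` on `L_∞`, and completeness extends this to `G`.

Infinite sums: a Lévy-type maximal inequality gives almost sure convergence when `‖a‖₂ < ∞`. Fatou's
lemma gives the upper bound, and truncation the lower one. If `‖a‖₂ = ∞`, the uniform lower
probability forces unbounded partial sums on a set of positive measure. -/

/-! ### The law of the Rademacher functions -/

/-- A sign, as a real number. -/
def sgn (b : ℤˣ) : ℝ := ((b : ℤ) : ℝ)

@[simp] lemma sgn_one : sgn 1 = 1 := by simp [sgn]

@[simp] lemma sgn_neg (b : ℤˣ) : sgn (-b) = -sgn b := by simp [sgn]

lemma sgn_mul (b c : ℤˣ) : sgn (b * c) = sgn b * sgn c := by simp [sgn]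

lemma sgn_eq (b : ℤˣ) : sgn b = 1 ∨ sgn b = -1 := by
  rcases Int.units_eq_one_or b with rfl | rfl <;> simp

lemma sgn_mul_self (b : ℤˣ) : sgn b * sgn b = 1 := by
  rcases sgn_eq b with h | h <;> simp [h]

lemma abs_sgn (b : ℤˣ) : |sgn b| = 1 := by
  rcases sgn_eq b with h | h <;> simp [h]

lemma sum_units_int {M : Type*} [AddCommMonoid M] (f : ℤˣ → M) : ∑ b, f b = f 1 + f (-1) := by
  have h : (Finset.univ : Finset ℤˣ) = {1, -1} := by decide
  rw [h, Finset.sum_pair (by decide)]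

lemma sum_fin_succ_units {M : Type*} [AddCommMonoid M] {K : ℕ} (f : (Fin (K + 1) → ℤˣ) → M) :
    ∑ ω, f ω = ∑ ω, f (Fin.cons 1 ω) + ∑ ω, f (Fin.cons (-1) ω) := by
  rw [← (Fin.consEquiv fun _ : Fin (K + 1) => ℤˣ).sum_comp, Fintype.sum_prod_type, sum_units_int]
  rfl

lemma rademacher_succ (k : ℕ) (t : ℝ) : rademacher (k + 1) t = rademacher k (2 * t) := by
  unfold rademacher
  congr 2
  ring

lemma rademacher_succ_sub_one (k : ℕ) (t : ℝ) :
    rademacher (k + 1) (t - 1) = rademacher (k + 1) t := by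
  unfold rademacher
  congr 1
  have : 2 ^ (k + 1) * Real.pi * (t - 1)
      = 2 ^ (k + 1) * Real.pi * t - ((2 ^ k : ℕ) : ℝ) * (2 * Real.pi) := by
    push_cast; ring
  rw [this, Real.sin_sub_nat_mul_two_pi]

lemma rademacher_zero {t : ℝ} (h0 : 0 < t) (h1 : t < 1) : rademacher 0 t = 1 := by
  unfold rademacher
  apply Real.sign_of_pos
  have := Real.pi_pos
  apply Real.sin_pos_of_pos_of_lt_pi <;> norm_num <;> nlinarith

lemma rademacher_one_left {t : ℝ} (h0 : 0 < t) (h1 : t < 1 / 2) : rademacher 1 t = 1 := by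
  rw [rademacher_succ]
  exact rademacher_zero (by linarith) (by linarith)

lemma rademacher_one_right {t : ℝ} (h0 : 1 / 2 < t) (h1 : t < 1) : rademacher 1 t = -1 := by
  unfold rademacher
  apply Real.sign_of_neg
  have := Real.pi_pos
  rw [← Real.sin_sub_two_pi]
  apply Real.sin_neg_of_neg_of_neg_pi_lt <;> norm_num <;> nlinarith

lemma setLIntegral_Ioo_two_mul_sub (g : ℝ → ℝ≥0∞) (b : ℝ) :
    ∫⁻ t in Set.Ioo (b / 2) ((b + 1) / 2), g (2 * t - b)
      = 2⁻¹ * ∫⁻ t in Set.Ioo (0 : ℝ) 1, g t := by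
  rw [← lintegral_indicator measurableSet_Ioo, ← lintegral_indicator measurableSet_Ioo]
  have h1 : (Set.Ioo (b / 2) ((b + 1) / 2)).indicator (fun t => g (2 * t - b))
      = fun t => (Set.Ioo (0 : ℝ) 1).indicator g (2 * t - b) := by
    ext t
    simp only [Set.indicator, Set.mem_Ioo]
    congr 1
    apply propext
    constructor <;> rintro ⟨h, h'⟩ <;> constructor <;> linarith
  rw [h1]
  set G := (Set.Ioo (0 : ℝ) 1).indicator g
  have h2 : ∫⁻ t, G (t - b) = ∫⁻ t, G t := lintegral_sub_right_eq_self G b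
  rw [← h2]
  have h3 := Real.smul_map_volume_mul_left (a := 2) (by norm_num)
  have h4 : ∫⁻ t, G (t - b) = 2 * ∫⁻ t, G (2 * t - b) := by
    conv_lhs => rw [← h3]
    rw [lintegral_smul_measure]
    have := (Homeomorph.mulLeft₀ (2 : ℝ) (by norm_num)).toMeasurableEquiv.measurableEmbedding
      |>.lintegral_map (μ := volume) (fun t => G (t - b))
    simp only [Homeomorph.toMeasurableEquiv_coe, Homeomorph.coe_mulLeft₀] at this
    rw [this]
    simp
  rw [h4, ← mul_assoc, ENNReal.inv_mul_cancel (by norm_num) (by norm_num), one_mul]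

/-- Independence by binary splitting: on each half of the interval `rademacher 1` is constant, and
`t ↦ 2t` or `t ↦ 2t - 1` carries the later functions to their predecessors on the whole interval. -/
lemma setLIntegral_rademacher_succ (K : ℕ) (ψ : (Fin K → ℝ) → ℝ≥0∞) :
    ∫⁻ t in Set.Ioo (0 : ℝ) 1, ψ (fun k => rademacher (k + 1) t)
      = (2 ^ K)⁻¹ * ∑ ω : Fin K → ℤˣ, ψ (fun k => sgn (ω k)) := by
  induction K with
  | zero =>
    have : ∀ f : Fin 0 → ℝ, ψ f = ψ default := fun f => by rw [Subsingleton.elim f default]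
    simp [this]
  | succ K ih =>
    have hsplit : (Set.Ioo (0 : ℝ) (1 / 2) ∪ Set.Ioo (1 / 2) 1 : Set ℝ)
        =ᵐ[volume] Set.Ioo (0 : ℝ) 1 := by
      have : (Set.Ioo (0 : ℝ) (1 / 2) ∪ Set.Ico (1 / 2) 1 : Set ℝ) = Set.Ioo (0 : ℝ) 1 :=
        Set.Ioo_union_Ico_eq_Ioo (by norm_num) (by norm_num)
      rw [← this]
      exact (ae_eq_refl _).union Ioo_ae_eq_Ico
    rw [← setLIntegral_congr hsplit, lintegral_union measurableSet_Ioo (by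
      rw [Set.disjoint_left]; rintro x ⟨_, h⟩ ⟨h', _⟩; linarith)]
    have hL : ∫⁻ t in Set.Ioo (0 : ℝ) (1 / 2), ψ (fun k => rademacher (k + 1) t)
        = 2⁻¹ * ((2 ^ K)⁻¹ * ∑ ω : Fin K → ℤˣ, ψ (Fin.cons 1 (fun k => sgn (ω k)))) := by
      rw [← ih (fun v => ψ (Fin.cons 1 v))]
      have := setLIntegral_Ioo_two_mul_sub
        (fun t => ψ (Fin.cons 1 (fun k : Fin K => rademacher (k + 1) t))) 0
      norm_num at this
      rw [← this]
      norm_num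
      refine setLIntegral_congr_fun measurableSet_Ioo fun t ht => ?_
      congr 1
      ext k
      refine Fin.cases ?_ (fun k => ?_) k
      · simpa using rademacher_one_left ht.1 (by simpa using ht.2)
      · simp [rademacher_succ (k + 1)]
    have hR : ∫⁻ t in Set.Ioo (1 / 2 : ℝ) 1, ψ (fun k => rademacher (k + 1) t)
        = 2⁻¹ * ((2 ^ K)⁻¹ * ∑ ω : Fin K → ℤˣ, ψ (Fin.cons (-1) (fun k => sgn (ω k)))) := by
      rw [← ih (fun v => ψ (Fin.cons (-1) v))]
      have := setLIntegral_Ioo_two_mul_sub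
        (fun t => ψ (Fin.cons (-1) (fun k : Fin K => rademacher (k + 1) t))) 1
      norm_num at this
      rw [← this]
      norm_num
      refine setLIntegral_congr_fun measurableSet_Ioo fun t ht => ?_
      congr 1
      ext k
      refine Fin.cases ?_ (fun k => ?_) k
      · simpa using rademacher_one_right (by simpa using ht.1) ht.2
      · simp [rademacher_succ (k + 1), rademacher_succ_sub_one]
    have hc : ∀ (b : ℤˣ) (ω : Fin K → ℤˣ),
        (fun k => sgn ((Fin.cons b ω : Fin (K + 1) → ℤˣ) k))
          = (Fin.cons (sgn b) (fun k => sgn (ω k)) : Fin (K + 1) → ℝ) := by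
      intro b ω
      ext k
      refine Fin.cases ?_ (fun k => ?_) k <;> simp
    rw [hL, hR, sum_fin_succ_units]
    simp only [hc, sgn_one, sgn_neg]
    rw [← mul_add, ← mul_add, ← mul_assoc, pow_succ, mul_comm (2 ^ K : ℝ≥0∞),
      ENNReal.mul_inv (by norm_num) (by norm_num)]

lemma ae_mem_Ioo_unitInterval : ∀ᵐ t : I, (t : ℝ) ∈ Set.Ioo (0 : ℝ) 1 := by
  have h0 : ∀ᵐ t : I, t ≠ 0 := by simp [ae_iff]
  have h1 : ∀ᵐ t : I, t ≠ 1 := by simp [ae_iff]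
  filter_upwards [h0, h1] with t h0 h1
  exact ⟨lt_of_le_of_ne t.2.1 fun h => h0 (Subtype.ext h.symm),
    lt_of_le_of_ne t.2.2 fun h => h1 (Subtype.ext h)⟩

lemma lintegral_unitInterval (g : ℝ → ℝ≥0∞) :
    ∫⁻ t : I, g t = ∫⁻ t in Set.Ioo (0 : ℝ) 1, g t := by
  rw [setLIntegral_congr Ioo_ae_eq_Icc]
  exact lintegral_subtype_comap measurableSet_Icc g

/-- The joint law of `r_1, …, r_K`. -/
lemma lintegral_rademacher_succ (K : ℕ) (ψ : (Fin K → ℝ) → ℝ≥0∞) :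
    ∫⁻ t : I, ψ (fun k => rademacher (k + 1) t)
      = (2 ^ K)⁻¹ * ∑ ω : Fin K → ℤˣ, ψ (fun k => sgn (ω k)) := by
  rw [lintegral_unitInterval fun t => ψ (fun k => rademacher (k + 1) t),
    setLIntegral_rademacher_succ]

/-- The `k`-th sign of `ω`. -/
def signSeq {M : ℕ} (ω : Fin (M + 1) → ℤˣ) (k : ℕ) : ℝ := sgn (ω (Fin.ofNat (M + 1) k))

/-- As far as even functions are concerned, the constant function `r_0` is as good as an
independent sign. -/
lemma lintegral_rademacher_of_even (M : ℕ) (ψ : (ℕ → ℝ) → ℝ≥0∞) (heven : ∀ s, ψ (-s) = ψ s)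
    (hdep : ∀ s s', (∀ k ≤ M, s k = s' k) → ψ s = ψ s') :
    ∫⁻ t : I, ψ (fun k => rademacher k t)
      = (2 ^ (M + 1))⁻¹ * ∑ ω : Fin (M + 1) → ℤˣ, ψ (signSeq ω) := by
  let prependOne : (Fin M → ℝ) → ℕ → ℝ := fun v k =>
    (Fin.cons 1 v : Fin (M + 1) → ℝ) (Fin.ofNat (M + 1) k)
  have h1 : ∫⁻ t : I, ψ (fun k => rademacher k t)
      = ∫⁻ t : I, ψ (prependOne (fun k => rademacher (k + 1) t)) := by
    refine lintegral_congr_ae ?_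
    filter_upwards [ae_mem_Ioo_unitInterval] with t ht
    refine hdep _ _ fun k hk => ?_
    simp only [prependOne]
    have hk' : Fin.ofNat (M + 1) k = ⟨k, by omega⟩ := by
      ext; simp only [Fin.val_ofNat]; exact Nat.mod_eq_of_lt (by omega)
    rw [hk']
    rcases k with _ | k
    · exact rademacher_zero ht.1 ht.2
    · rfl
  rw [h1, lintegral_rademacher_succ M (fun v => ψ (prependOne v)), sum_fin_succ_units]
  have h2 : ∀ ω : Fin M → ℤˣ,
      signSeq (Fin.cons 1 ω : Fin (M + 1) → ℤˣ) = prependOne fun k => sgn (ω k) := by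
    intro ω
    ext k
    simp only [signSeq, prependOne]
    refine Fin.cases ?_ (fun k => ?_) (Fin.ofNat (M + 1) k) <;> simp
  -- A first sign `-1` can be traded for the first sign `1` by negating the whole sequence, which an
  -- even function does not notice.
  have h3 : ∀ ω : Fin M → ℤˣ, ψ (signSeq (Fin.cons (-1) (-ω) : Fin (M + 1) → ℤˣ))
      = ψ (prependOne fun k => sgn (ω k)) := by
    intro ω
    rw [← heven, ← h2]
    congr 1
    ext k
    simp only [signSeq, Pi.neg_apply]
    refine Fin.cases ?_ (fun k => ?_) (Fin.ofNat (M + 1) k) <;> simp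
  have h4 : ∑ ω : Fin M → ℤˣ, ψ (signSeq (Fin.cons (-1) ω : Fin (M + 1) → ℤˣ))
      = ∑ ω : Fin M → ℤˣ, ψ (prependOne fun k => sgn (ω k)) := by
    rw [← Equiv.sum_comp (Equiv.neg (Fin M → ℤˣ))]
    exact Finset.sum_congr rfl fun ω _ => h3 ω
  rw [h4]
  simp only [h2]
  rw [← two_mul, ← mul_assoc, pow_succ, ENNReal.mul_inv (by norm_num) (by norm_num), mul_assoc,
    mul_assoc, ← mul_assoc 2⁻¹, ENNReal.inv_mul_cancel (by norm_num) (by norm_num), one_mul]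

lemma rademacher_mem (k : ℕ) (t : ℝ) : rademacher k t ∈ ({-1, 0, 1} : Set ℝ) := by
  unfold rademacher
  rcases Real.sign_apply_eq (Real.sin (2 ^ k * Real.pi * t)) with h | h | h <;> simp [h]

/-- Functions of finitely many Rademacher functions are measurable. -/
lemma measurable_comp_rademacher {β : Type*} [MeasurableSpace β] (M : ℕ) (ψ : (ℕ → ℝ) → β)
    (hdep : ∀ s s', (∀ k ≤ M, s k = s' k) → ψ s = ψ s') :
    Measurable fun t : I => ψ (fun k => rademacher k t) := by
  let v : I → Fin (M + 1) → ℝ := fun t k => rademacher k t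
  have hv : Measurable v := measurable_pi_lambda _ fun k =>
    (measurable_rademacher k).comp measurable_subtype_coe
  have hfin : (Set.range v).Finite := by
    refine (Set.Finite.pi' (t := fun _ : Fin (M + 1) => ({-1, 0, 1} : Set ℝ))
      fun _ => by simp).subset ?_
    rintro _ ⟨t, rfl⟩ k
    exact rademacher_mem k t
  let φ : (Fin (M + 1) → ℝ) → β := fun w => ψ fun k => w (Fin.ofNat (M + 1) k)
  have hφ : (fun t : I => ψ (fun k => rademacher k t)) = φ ∘ v := by
    ext t
    refine hdep _ _ fun k hk => ?_
    simp only [v, Fin.val_ofNat]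
    rw [Nat.mod_eq_of_lt (by omega)]
  rw [hφ]
  intro s _
  rw [Set.preimage_comp, ← Set.preimage_inter_range]
  exact hv (hfin.subset Set.inter_subset_right).measurableSet

/-! ### Sums of independent signs -/

section Cube

variable {κ ι : Type*} [Fintype κ] [DecidableEq κ]

lemma card_cube : (Fintype.card (κ → ℤˣ) : ℝ) = 2 ^ Fintype.card κ := by
  rw [Fintype.card_fun, Fintype.card_units_int]
  norm_num

lemma sum_cube_mul {M : Type*} [AddCommMonoid M] (η : κ → ℤˣ) (f : (κ → ℤˣ) → M) :
    ∑ ω, f (η * ω) = ∑ ω, f ω :=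
  Equiv.sum_comp (Equiv.mulLeft η) f

/-- A majorant `h` that dominates its own one-step averages controls sums of independent signs. -/
lemma sum_cube_le (e : ι → κ) (a : ι → ℝ) (g : ℝ → ℝ) (h : ℝ → ℝ → ℝ) (V : ℝ)
    (h0 : ∀ x, g x ≤ h x 0)
    (hstep : ∀ x b v, 0 ≤ v → v + b ^ 2 ≤ V → h (x + b) v + h (x - b) v ≤ 2 * h x (v + b ^ 2))
    (F : Finset ι) (he : Set.InjOn e F) (hV : ∑ p ∈ F, a p ^ 2 ≤ V) (x : ℝ) :
    ∑ ω : κ → ℤˣ, g (x + ∑ p ∈ F, a p * sgn (ω (e p)))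
      ≤ 2 ^ Fintype.card κ * h x (∑ p ∈ F, a p ^ 2) := by
  classical
  induction F using Finset.induction_on generalizing x with
  | empty =>
    simp only [Finset.sum_empty, add_zero, Finset.sum_const, Finset.card_univ, nsmul_eq_mul, card_cube]
    exact mul_le_mul_of_nonneg_left (h0 x) (by positivity)
  | insert p F hp ih =>
    rw [Finset.sum_insert hp] at hV ⊢
    have hv0 : 0 ≤ ∑ p ∈ F, a p ^ 2 := Finset.sum_nonneg fun _ _ => sq_nonneg _
    have ih' := ih (he.mono (by simp)) (by nlinarith [sq_nonneg (a p)])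
    have hflip : ∀ ω : κ → ℤˣ, ∀ q ∈ F, ((Pi.mulSingle (e p) (-1) : κ → ℤˣ) * ω) (e q) = ω (e q) := by
      intro ω q hq
      have : e q ≠ e p := fun h => hp (by
        rw [← he (by simp [hq]) (by simp) h]; exact hq)
      simp [Pi.mulSingle_eq_of_ne this]
    -- By injectivity no term of `F` uses the coordinate `e p`. Flipping it only reverses the sign
    -- of `a p`, so adding the two expressions for the sum removes `ω (e p)` altogether.
    have hA : ∑ ω : κ → ℤˣ, g (x + ∑ q ∈ insert p F, a q * sgn (ω (e q)))
        = ∑ ω : κ → ℤˣ, g (x - a p * sgn (ω (e p)) + ∑ q ∈ F, a q * sgn (ω (e q))) := by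
      rw [← sum_cube_mul (Pi.mulSingle (e p) (-1) : κ → ℤˣ)]
      refine Finset.sum_congr rfl fun ω _ => ?_
      rw [Finset.sum_insert hp, Finset.sum_congr rfl fun q hq => by rw [hflip ω q hq]]
      congr 1
      simp
      ring
    have hB : ∑ ω : κ → ℤˣ, g (x + ∑ q ∈ insert p F, a q * sgn (ω (e q)))
        = ∑ ω : κ → ℤˣ, g (x + a p * sgn (ω (e p)) + ∑ q ∈ F, a q * sgn (ω (e q))) := by
      refine Finset.sum_congr rfl fun ω _ => ?_
      rw [Finset.sum_insert hp, add_assoc]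
    have hC : 2 * ∑ ω : κ → ℤˣ, g (x + ∑ q ∈ insert p F, a q * sgn (ω (e q)))
        = ∑ ω : κ → ℤˣ, g (x + a p + ∑ q ∈ F, a q * sgn (ω (e q)))
          + ∑ ω : κ → ℤˣ, g (x - a p + ∑ q ∈ F, a q * sgn (ω (e q))) := by
      rw [two_mul]
      nth_rewrite 1 [hA]
      rw [hB, ← Finset.sum_add_distrib, ← Finset.sum_add_distrib]
      refine Finset.sum_congr rfl fun ω _ => ?_
      rcases sgn_eq (ω (e p)) with h | h <;> simp only [h, mul_one, mul_neg, sub_neg_eq_add]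
      · rw [add_comm]
      · rw [sub_eq_add_neg]
    have h1 := ih' (x + a p)
    have h2 := ih' (x - a p)
    have h3 := hstep x (a p) _ hv0 (by linarith)
    have h4 : (0 : ℝ) < 2 ^ Fintype.card κ := by positivity
    rw [add_comm (a p ^ 2)]
    nlinarith

/-- Rademacher sums are subgaussian. -/
lemma sum_cube_exp_sq_le (e : ι → κ) (a : ι → ℝ) (F : Finset ι) (he : Set.InjOn e F) {τ : ℝ}
    (hτ : 0 < τ) (hV : ∑ p ∈ F, a p ^ 2 ≤ τ ^ 2) :
    ∑ ω : κ → ℤˣ, Real.exp (((∑ p ∈ F, a p * sgn (ω (e p))) / (3 * τ)) ^ 2)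
      ≤ 2 ^ Fintype.card κ * 2 := by
  -- `B` solves `B' = 2B²`, which is what the factor `cosh s ≤ exp (s² / 2)` costs in the one-step
  -- inequality. The level `3τ` keeps the exponent at `x = 0` at most `1/7`, and `exp (1/7) ≤ 2`.
  let B : ℝ → ℝ := fun v => (9 * τ ^ 2 - 2 * v)⁻¹
  have key := sum_cube_le e a (fun x => Real.exp ((x / (3 * τ)) ^ 2))
    (fun x v => Real.exp (B v * (x ^ 2 + v))) (τ ^ 2) ?_ ?_ F he hV 0
  · simp only [zero_add] at key
    refine key.trans (mul_le_mul_of_nonneg_left ?_ (by positivity))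
    have hv0 : 0 ≤ ∑ p ∈ F, a p ^ 2 := Finset.sum_nonneg fun _ _ => sq_nonneg _
    set v := ∑ p ∈ F, a p ^ 2
    have h1 : B v * (0 ^ 2 + v) ≤ 1 / 7 := by
      have : 0 < 9 * τ ^ 2 - 2 * v := by nlinarith
      simp only [B]
      rw [inv_mul_le_iff₀ this]
      nlinarith
    have h2 : Real.exp (1 / 7) ≤ 2 := by
      have := Real.exp_bound_div_one_sub_of_interval (x := 1 / 7) (by norm_num) (by norm_num)
      norm_num at this ⊢
      linarith
    exact (Real.exp_le_exp.2 h1).trans h2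
  · intro x
    apply Real.exp_le_exp.2
    simp only [B]
    apply le_of_eq
    field_simp
    ring
  · intro x b v hv hvV
    have hD : 0 < 9 * τ ^ 2 - 2 * (v + b ^ 2) := by nlinarith
    have hD' : 0 < 9 * τ ^ 2 - 2 * v := by nlinarith [sq_nonneg b]
    have hBpos : 0 < B v := inv_pos.2 hD'
    have h1 : Real.exp (B v * ((x + b) ^ 2 + v)) + Real.exp (B v * ((x - b) ^ 2 + v))
        = 2 * (Real.exp (B v * (x ^ 2 + b ^ 2 + v)) * Real.cosh (2 * B v * x * b)) := by
      rw [Real.cosh_eq, mul_div_assoc', mul_div_cancel₀ _ (by norm_num : (2 : ℝ) ≠ 0),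
        mul_add (Real.exp _), ← Real.exp_add, ← Real.exp_add]
      congr 2 <;> ring
    rw [h1]
    have h2 := Real.cosh_le_exp_half_sq (2 * B v * x * b)
    have h3 : B v * (x ^ 2 + b ^ 2 + v) + (2 * B v * x * b) ^ 2 / 2
        ≤ B (v + b ^ 2) * (x ^ 2 + (v + b ^ 2)) := by
      have hB1 : B v ≤ B (v + b ^ 2) := by
        apply inv_anti₀ hD; nlinarith [sq_nonneg b]
      have hB2 : B v + 2 * B v ^ 2 * b ^ 2 ≤ B (v + b ^ 2) := by
        have : B (v + b ^ 2) = B v + 2 * B v * B (v + b ^ 2) * b ^ 2 := by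
          simp only [B]; field_simp; ring
        nlinarith [mul_le_mul_of_nonneg_left hB1 (mul_nonneg hBpos.le (sq_nonneg b))]
      nlinarith [mul_le_mul_of_nonneg_right hB2 (sq_nonneg x),
        mul_le_mul_of_nonneg_right hB1 (add_nonneg hv (sq_nonneg b))]
    calc 2 * (Real.exp (B v * (x ^ 2 + b ^ 2 + v)) * Real.cosh (2 * B v * x * b))
        ≤ 2 * (Real.exp (B v * (x ^ 2 + b ^ 2 + v)) * Real.exp ((2 * B v * x * b) ^ 2 / 2)) := by
          gcongr
      _ ≤ _ := by
          rw [← Real.exp_add]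
          gcongr

/-- The majorant principle applied to `-x²` yields the lower bound on the second moment. -/
lemma sum_cube_sq (e : ι → κ) (a : ι → ℝ) (F : Finset ι) (he : Set.InjOn e F) :
    2 ^ Fintype.card κ * ∑ p ∈ F, a p ^ 2
      ≤ ∑ ω : κ → ℤˣ, (∑ p ∈ F, a p * sgn (ω (e p))) ^ 2 := by
  have key := sum_cube_le e a (fun x => -x ^ 2) (fun x v => -(x ^ 2 + v)) (∑ p ∈ F, a p ^ 2)
    (fun x => by simp) (fun x b v _ _ => by nlinarith) F he le_rfl 0
  simp only [zero_add, Finset.sum_neg_distrib] at key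
  nlinarith

/-- The majorant is the fourth moment of `x` plus a centred Gaussian of variance `v`. -/
lemma sum_cube_pow_four_le (e : ι → κ) (a : ι → ℝ) (F : Finset ι) (he : Set.InjOn e F) :
    ∑ ω : κ → ℤˣ, (∑ p ∈ F, a p * sgn (ω (e p))) ^ 4
      ≤ 2 ^ Fintype.card κ * (3 * (∑ p ∈ F, a p ^ 2) ^ 2) := by
  have key := sum_cube_le e a (fun x => x ^ 4) (fun x v => x ^ 4 + 6 * x ^ 2 * v + 3 * v ^ 2)
    (∑ p ∈ F, a p ^ 2) (fun x => by simp)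
    (fun x b v hv _ => by nlinarith [sq_nonneg (b ^ 2)]) F he le_rfl 0
  simpa using key

/-- Paley–Zygmund inequality for Rademacher sums. -/
lemma card_cube_abs_ge (e : ι → κ) (a : ι → ℝ) (F : Finset ι) (he : Set.InjOn e F) {τ : ℝ}
    (hτ : 0 < τ) (hV : ∑ p ∈ F, a p ^ 2 = τ ^ 2) :
    3 / 16 * (2 : ℝ) ^ Fintype.card κ
      ≤ (Finset.univ.filter fun ω : κ → ℤˣ => τ / 2 ≤ |∑ p ∈ F, a p * sgn (ω (e p))|).card := by
  set S : (κ → ℤˣ) → ℝ := fun ω => ∑ p ∈ F, a p * sgn (ω (e p))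
  set T := Finset.univ.filter fun ω : κ → ℤˣ => τ / 2 ≤ |S ω|
  have h2 : 2 ^ Fintype.card κ * τ ^ 2 ≤ ∑ ω, S ω ^ 2 := hV ▸ sum_cube_sq e a F he
  have h4 : ∑ ω, S ω ^ 4 ≤ 2 ^ Fintype.card κ * (3 * (τ ^ 2) ^ 2) :=
    hV ▸ sum_cube_pow_four_le e a F he
  -- On `T` this is `(S² - 4τ²)² ≥ 0`. Averaging gives `τ² ≤ τ²/4 + 3τ²/8 + 2τ² P(T)`, hence `P(T) ≥
  -- 3/16`.
  have hpt : ∀ ω, S ω ^ 2 ≤ τ ^ 2 / 4 + (S ω ^ 4 / (8 * τ ^ 2)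
      + (if ω ∈ T then 2 * τ ^ 2 else 0)) := by
    intro ω
    have h8 : 0 ≤ S ω ^ 4 / (8 * τ ^ 2) := by positivity
    split_ifs with h
    · have : S ω ^ 4 / (8 * τ ^ 2) + 2 * τ ^ 2 - S ω ^ 2
          = (S ω ^ 2 - 4 * τ ^ 2) ^ 2 / (8 * τ ^ 2) := by field_simp; ring
      have h9 : 0 ≤ (S ω ^ 2 - 4 * τ ^ 2) ^ 2 / (8 * τ ^ 2) := by positivity
      nlinarith [sq_nonneg τ]
    · have h' : |S ω| < τ / 2 := by simpa [T] using h
      have : S ω ^ 2 ≤ (τ / 2) ^ 2 := by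
        rw [← sq_abs]; exact pow_le_pow_left₀ (abs_nonneg _) h'.le 2
      nlinarith
  have hsum := Finset.sum_le_sum fun ω (_ : ω ∈ Finset.univ) => hpt ω
  simp only [Finset.sum_add_distrib, ← Finset.sum_div, Finset.sum_ite_mem, Finset.univ_inter,
    Finset.sum_const, nsmul_eq_mul, Finset.card_univ, card_cube] at hsum
  have h5 : (∑ ω, S ω ^ 4) / (8 * τ ^ 2) ≤ 2 ^ Fintype.card κ * (3 / 8 * τ ^ 2) := by
    rw [div_le_iff₀ (by positivity)]
    refine h4.trans (le_of_eq ?_)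
    ring
  have h6 : 0 < τ ^ 2 := by positivity
  have h7 : (3 / 16 * (2 : ℝ) ^ Fintype.card κ) * τ ^ 2 ≤ T.card * τ ^ 2 := by nlinarith
  exact le_of_mul_le_mul_right h7 h6

lemma card_cube_ge (F : Finset κ) {τ : ℝ} (hτ : 0 < τ) (hF : (F.card : ℝ) = τ ^ 2) :
    3 / 32 * (2 : ℝ) ^ Fintype.card κ
      ≤ (Finset.univ.filter fun ω : κ → ℤˣ => τ / 2 ≤ ∑ p ∈ F, sgn (ω p)).card := by
  have h1 := card_cube_abs_ge (id : κ → κ) (fun _ => 1) F Function.injective_id.injOn hτ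
    (by simpa using hF)
  simp only [one_mul, id] at h1
  set A := Finset.univ.filter fun ω : κ → ℤˣ => τ / 2 ≤ ∑ p ∈ F, sgn (ω p)
  set A' := Finset.univ.filter fun ω : κ → ℤˣ => τ / 2 ≤ -∑ p ∈ F, sgn (ω p)
  have h2 : A'.card = A.card := by
    refine Finset.card_bij (fun ω _ => -ω) ?_ (fun _ _ _ _ h => neg_injective h) ?_
    · intro ω hω
      simpa [A, A'] using hω
    · intro ω hω
      exact ⟨-ω, by simpa [A, A'] using hω, neg_neg ω⟩
  have h3 : (Finset.univ.filter fun ω : κ → ℤˣ => τ / 2 ≤ |∑ p ∈ F, sgn (ω p)|) ⊆ A ∪ A' := by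
    intro ω hω
    simp only [Finset.mem_filter, Finset.mem_univ, true_and, le_abs, Finset.mem_union, A, A']
      at hω ⊢
    exact hω
  have h4 := (Finset.card_le_card h3).trans (Finset.card_union_le A A')
  rw [h2] at h4
  have h5 : ((Finset.univ.filter fun ω : κ → ℤˣ => τ / 2 ≤ |∑ p ∈ F, sgn (ω p)|).card : ℝ)
      ≤ A.card + A.card := by exact_mod_cast h4
  linarith

end Cube

lemma card_cube_add_ge (m n : ℕ) (s t : ℝ) :
    (Finset.univ.filter fun ω : Fin m → ℤˣ => s ≤ ∑ p, sgn (ω p)).card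
      * (Finset.univ.filter fun ω : Fin n → ℤˣ => t ≤ ∑ p, sgn (ω p)).card
      ≤ (Finset.univ.filter fun ω : Fin (m + n) → ℤˣ => s + t ≤ ∑ p, sgn (ω p)).card := by
  rw [← Finset.card_product]
  refine Finset.card_le_card_of_injOn (fun p => Fin.append p.1 p.2) ?_ ?_
  · rintro ⟨ω, ω'⟩ h
    simp only [Finset.coe_product, Finset.coe_filter, Finset.mem_univ, true_and, Set.mem_prod,
      Set.mem_ofPred_eq] at h ⊢
    rw [Fin.sum_univ_add]
    simp only [Fin.append_left, Fin.append_right]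
    linarith [h.1, h.2]
  · rintro ⟨ω, ω'⟩ _ ⟨η, η'⟩ _ h
    exact (Fin.appendEquiv m n).injective h

/-- Lower bound for the tails of `r_1 + … + r_{4^J}`. -/
lemma card_cube_tail (i m : ℕ) :
    (3 / 32 : ℝ) ^ (4 ^ i) * 2 ^ (4 ^ (i + m)) ≤ (Finset.univ.filter fun ω : Fin (4 ^ (i + m)) → ℤˣ =>
      (2 : ℝ) ^ (2 * i + m) / 2 ≤ ∑ p, sgn (ω p)).card := by
  -- The variables form `4 ^ i` blocks of length `4 ^ m`, each with sum at least `2 ^ m / 2` with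
  -- probability at least `3/32`. The induction step joins four copies.
  induction i with
  | zero =>
    have h : ∀ N, N = 4 ^ m → 3 / 32 * (2 : ℝ) ^ N ≤ (Finset.univ.filter
        fun ω : Fin N → ℤˣ => (2 : ℝ) ^ m / 2 ≤ ∑ p, sgn (ω p)).card := by
      intro N hN
      have h := card_cube_ge (Finset.univ : Finset (Fin N)) (τ := 2 ^ m) (by positivity) (by
        rw [Finset.card_univ, Fintype.card_fin, hN, ← pow_mul, mul_comm m 2, pow_mul]
        norm_num)
      simpa using h
    simpa using h (4 ^ (0 + m)) (by simp)
  | succ i ih =>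
    set N := 4 ^ (i + m)
    set s := (2 : ℝ) ^ (2 * i + m) / 2
    have h1 := card_cube_add_ge N N s s
    have h2 := card_cube_add_ge (N + N) (N + N) (s + s) (s + s)
    have hN : 4 ^ (i + 1 + m) = N + N + (N + N) := by simp only [N]; ring
    have hs : (2 : ℝ) ^ (2 * (i + 1) + m) / 2 = s + s + (s + s) := by simp only [s]; ring
    rw [hN, hs]
    set c := (Finset.univ.filter fun ω : Fin N → ℤˣ => s ≤ ∑ p, sgn (ω p)).card
    have h3 : c * c * (c * c) ≤ _ := (Nat.mul_le_mul h1 h1).trans h2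
    have h4 := (Nat.cast_le (α := ℝ)).2 h3
    simp only [Nat.cast_mul] at h4
    refine le_trans (le_of_eq_of_le ?_ (pow_le_pow_left₀ (by positivity) ih 4))
      (le_of_eq_of_le ?_ h4)
    · rw [mul_pow, ← pow_mul, ← pow_mul, pow_succ]
      congr 2
      ring
    · ring

/-- Maximal inequality: `τ k` preserves `F j` for `j ≤ k`, and `F k` is at most the average of
`F n` over the orbits of `τ k`. -/
lemma maximal_inequality {Ω : Type*} [Fintype Ω] (F : ℕ → Ω → ℝ≥0∞) (τ : ℕ → Equiv.Perm Ω)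
    (m n : ℕ) (hτ : ∀ j k ω, j ≤ k → F j (τ k ω) = F j ω)
    (havg : ∀ k ω, k ≤ n → 2 * F k ω ≤ F n ω + F n (τ k ω)) (ε : ℝ≥0∞) :
    ∑ ω, Set.indicator {ω | ∃ k, m ≤ k ∧ k ≤ n ∧ ε < F k ω} (fun _ => ε) ω ≤ ∑ ω, F n ω := by
  classical
  -- `A k` is the event that `k` is the first index from `m` on with `F k > ε`. It is invariant
  -- under `τ k`, so `F n` may be symmetrized over it.
  let A : ℕ → Set Ω := fun k => {ω | m ≤ k ∧ ε < F k ω ∧ ∀ j, m ≤ j → j < k → F j ω ≤ ε}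
  have hA : ∀ k ω, τ k ω ∈ A k ↔ ω ∈ A k := by
    intro k ω
    simp only [A, Set.mem_ofPred_eq, hτ k k ω le_rfl]
    refine and_congr_right fun _ => and_congr_right fun _ => ?_
    refine forall_congr' fun j => forall_congr' fun _ => forall_congr' fun hj => ?_
    rw [hτ j k ω hj.le]
  have hdisj : ∀ k l ω, ω ∈ A k → ω ∈ A l → k = l := by
    intro k l ω hk hl
    rcases lt_trichotomy k l with h | h | h
    · exact absurd hk.2.1 (not_lt.2 (hl.2.2 k hk.1 h))
    · exact h
    · exact absurd hl.2.1 (not_lt.2 (hk.2.2 l hl.1 h))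
  have h1 : ∀ k ≤ n, ∑ ω, (A k).indicator (fun _ => ε) ω ≤ ∑ ω, (A k).indicator (F n) ω := by
    intro k hk
    have h2 : 2 * ∑ ω, (A k).indicator (fun _ => ε) ω ≤ 2 * ∑ ω, (A k).indicator (F n) ω := by
      have h3 : ∑ ω, (A k).indicator (F n) ω = ∑ ω, (A k).indicator (F n) (τ k ω) :=
        (Equiv.sum_comp (τ k) _).symm
      rw [two_mul (∑ ω, (A k).indicator (F n) ω)]
      nth_rewrite 2 [h3]
      rw [← Finset.sum_add_distrib, Finset.mul_sum]
      refine Finset.sum_le_sum fun ω _ => ?_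
      by_cases hω : ω ∈ A k
      · rw [Set.indicator_of_mem hω, Set.indicator_of_mem hω,
          Set.indicator_of_mem ((hA k ω).2 hω)]
        exact (mul_le_mul_right hω.2.1.le 2).trans (havg k ω hk)
      · simp [Set.indicator_of_notMem hω]
    exact (ENNReal.mul_le_mul_iff_right (by norm_num) (by norm_num)).1 h2
  calc ∑ ω, Set.indicator {ω | ∃ k, m ≤ k ∧ k ≤ n ∧ ε < F k ω} (fun _ => ε) ω
      ≤ ∑ ω, ∑ k ∈ Finset.range (n + 1), (A k).indicator (fun _ => ε) ω := by
        refine Finset.sum_le_sum fun ω _ => ?_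
        refine Set.indicator_apply_le' (fun h => ?_) fun _ => zero_le
        have hex : ∃ k, m ≤ k ∧ ε < F k ω := by
          obtain ⟨k, hk, _, h⟩ := h; exact ⟨k, hk, h⟩
        have hmem : ω ∈ A (Nat.find hex) := by
          refine ⟨(Nat.find_spec hex).1, (Nat.find_spec hex).2, fun j hj hj' => ?_⟩
          by_contra hlt
          exact Nat.find_min hex hj' ⟨hj, not_le.1 hlt⟩
        have hle : Nat.find hex ≤ n := by
          obtain ⟨k, hk, hkn, h⟩ := h
          exact (Nat.find_min' hex ⟨hk, h⟩).trans hkn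
        refine le_trans ?_ (Finset.single_le_sum (f := fun k => (A k).indicator (fun _ => ε) ω)
          (fun _ _ => zero_le) (Finset.mem_range.2 (Nat.lt_succ_of_le hle)))
        rw [Set.indicator_of_mem hmem]
    _ = ∑ k ∈ Finset.range (n + 1), ∑ ω, (A k).indicator (fun _ => ε) ω := Finset.sum_comm
    _ ≤ ∑ k ∈ Finset.range (n + 1), ∑ ω, (A k).indicator (F n) ω :=
        Finset.sum_le_sum fun k hk => h1 k (Nat.lt_succ_iff.1 (Finset.mem_range.1 hk))
    _ = ∑ ω, ∑ k ∈ Finset.range (n + 1), (A k).indicator (F n) ω := Finset.sum_comm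
    _ ≤ ∑ ω, F n ω := by
        refine Finset.sum_le_sum fun ω _ => ?_
        by_cases h : ∃ k ∈ Finset.range (n + 1), ω ∈ A k
        · obtain ⟨k, hk, hω⟩ := h
          rw [Finset.sum_eq_single_of_mem k hk fun l _ hl =>
            Set.indicator_of_notMem (fun h => hl (hdisj l k ω h hω)) _]
          exact Set.indicator_apply_le' (fun _ => le_rfl) fun _ => zero_le
        · push Not at h
          rw [Finset.sum_eq_zero fun k hk => Set.indicator_of_notMem (h k hk) _]
          exact zero_le

/-! ### Decreasing rearrangements -/

/-- The decreasing rearrangement of `|f|`. -/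
noncomputable def decreasingRearrangement (f : I → ℝ) (t : I) : ℝ :=
  -- At `t = 0` no level need qualify, since `|f|` may be unbounded. The value at this null point is
  -- immaterial.
  if t = 0 then 0 else
    sInf {τ : ℝ | 0 ≤ τ ∧ (volume : Measure I) {s | τ < |f s|} ≤ ENNReal.ofReal t}

section Rearrangement

variable {f : I → ℝ}

lemma decreasingRearrangement_nonneg (t : I) : 0 ≤ decreasingRearrangement f t := by
  unfold decreasingRearrangement
  split_ifs
  · exact le_rfl
  · exact Real.sInf_nonneg fun τ hτ => hτ.1

lemma rearrangement_levels_nonempty (hf : Measurable f) {t : I} (ht : t ≠ 0) :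
    {τ : ℝ | 0 ≤ τ ∧ (volume : Measure I) {s | τ < |f s|} ≤ ENNReal.ofReal t}.Nonempty := by
  have h1 : Tendsto (fun n : ℕ => (volume : Measure I) {s | (n : ℝ) < |f s|}) atTop
      (𝓝 ((volume : Measure I) (⋂ n : ℕ, {s | (n : ℝ) < |f s|}))) := by
    refine tendsto_measure_iInter_atTop
      (fun n => (measurableSet_lt measurable_const hf.abs).nullMeasurableSet)
      (fun m n hmn s hs => (Nat.cast_le (α := ℝ).2 hmn).trans_lt hs) ⟨0, measure_ne_top _ _⟩
  have h2 : (⋂ n : ℕ, {s : I | (n : ℝ) < |f s|}) = ∅ := by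
    ext s
    simp only [Set.mem_iInter, Set.mem_ofPred_eq, Set.mem_empty_iff_false, iff_false, not_forall,
      not_lt]
    exact exists_nat_ge _
  rw [h2, measure_empty] at h1
  have h3 : (0 : ℝ≥0∞) < ENNReal.ofReal t :=
    ENNReal.ofReal_pos.2 (lt_of_le_of_ne t.2.1 fun h => ht (Subtype.ext h.symm))
  obtain ⟨n, hn⟩ := (h1.eventually (gt_mem_nhds h3)).exists
  exact ⟨n, Nat.cast_nonneg n, hn.le⟩

/-- The distribution function is right-continuous, so the infimum defining the rearrangement is
attained. -/
lemma lt_decreasingRearrangement_iff (hf : Measurable f) {τ : ℝ} (hτ : 0 ≤ τ) {t : I}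
    (ht : t ≠ 0) : τ < decreasingRearrangement f t ↔
      ENNReal.ofReal t < (volume : Measure I) {s | τ < |f s|} := by
  rw [← not_le, ← not_le, not_iff_not, decreasingRearrangement, if_neg ht]
  constructor
  · intro h
    have h1 : {s : I | τ < |f s|} = ⋃ n : ℕ, {s : I | τ + 1 / ((n : ℝ) + 1) < |f s|} := by
      ext s
      simp only [Set.mem_ofPred_eq, Set.mem_iUnion]
      constructor
      · intro hs
        obtain ⟨n, hn⟩ := exists_nat_one_div_lt (sub_pos.2 hs)
        exact ⟨n, by linarith⟩
      · rintro ⟨n, hn⟩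
        have : (0 : ℝ) < 1 / ((n : ℝ) + 1) := by positivity
        linarith
    have hmono : Monotone fun n : ℕ => {s : I | τ + 1 / ((n : ℝ) + 1) < |f s|} := by
      intro m n hmn s hs
      have : 1 / ((n : ℝ) + 1) ≤ 1 / ((m : ℝ) + 1) :=
        one_div_le_one_div_of_le (by positivity) (by simpa using hmn)
      simp only [Set.mem_ofPred_eq] at hs ⊢
      linarith
    rw [h1, hmono.measure_iUnion]
    refine iSup_le fun n => ?_
    have hpos : (0 : ℝ) < 1 / ((n : ℝ) + 1) := by positivity
    obtain ⟨τ', hτ', hlt⟩ := exists_lt_of_csInf_lt (rearrangement_levels_nonempty hf ht)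
      (lt_of_le_of_lt h (lt_add_of_pos_right τ hpos))
    exact (measure_mono fun s hs => hlt.trans hs).trans hτ'.2
  · intro h
    exact csInf_le ⟨0, fun _ h => h.1⟩ ⟨hτ, h⟩

lemma setOf_lt_decreasingRearrangement (hf : Measurable f) {τ : ℝ} (hτ : 0 ≤ τ) :
    {t : I | τ < decreasingRearrangement f t}
      = {t : I | (t : ℝ) < ((volume : Measure I) {s | τ < |f s|}).toReal} \ {0} := by
  ext t
  by_cases ht : t = 0
  · simp [ht, decreasingRearrangement, hτ]
  · simp only [Set.mem_ofPred_eq, lt_decreasingRearrangement_iff hf hτ ht, Set.mem_sdiff,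
      Set.mem_singleton_iff, ht, not_false_eq_true, and_true]
    rw [ENNReal.ofReal_lt_iff_lt_toReal t.2.1 (measure_ne_top _ _)]

lemma measurable_decreasingRearrangement (hf : Measurable f) :
    Measurable (decreasingRearrangement f) := by
  refine measurable_of_Ioi fun τ => ?_
  rcases lt_or_ge τ 0 with h | h
  · have : decreasingRearrangement f ⁻¹' Set.Ioi τ = Set.univ :=
      Set.eq_univ_of_forall fun t => lt_of_lt_of_le h (decreasingRearrangement_nonneg t)
    rw [this]
    exact MeasurableSet.univ
  · have : decreasingRearrangement f ⁻¹' Set.Ioi τ = {t : I | τ < decreasingRearrangement f t} :=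
      rfl
    rw [this, setOf_lt_decreasingRearrangement hf h]
    exact (measurableSet_lt measurable_subtype_coe measurable_const).diff
      (measurableSet_singleton 0)

lemma volume_lt_decreasingRearrangement (hf : Measurable f) {τ : ℝ} (hτ : 0 ≤ τ) :
    (volume : Measure I) {t | τ < decreasingRearrangement f t}
      = (volume : Measure I) {s | τ < |f s|} := by
  rw [setOf_lt_decreasingRearrangement hf hτ, measure_sdiff_null (by simp)]
  set D := (volume : Measure I) {s | τ < |f s|}
  have hD : D ≤ 1 := prob_le_one
  have h1 : {t : I | (t : ℝ) < D.toReal} = Set.Iio ⟨D.toReal, ENNReal.toReal_nonneg,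
      by simpa using ENNReal.toReal_mono ENNReal.one_ne_top hD⟩ := rfl
  rw [h1, unitInterval.volume_Iio]
  exact ENNReal.ofReal_toReal (measure_ne_top _ _)

end Rearrangement

lemma volume_congr_measFun {x : MeasFun} {f : I → ℝ} (h : x =ᵐ[volume] f) (p : ℝ → Prop) :
    (volume : Measure I) {t | p (x t)} = (volume : Measure I) {t | p (f t)} := by
  refine measure_congr ?_
  filter_upwards [h] with t ht
  exact propext (by change p (x t) ↔ p (f t); rw [ht])

/-! ### Symmetric spaces -/

namespace SymmetricSpace

variable (X : SymmetricSpace)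

lemma norm_zero : X.norm 0 = 0 := by
  have := X.norm_smul 0 0
  simpa using this

lemma norm_neg (x : MeasFun) : X.norm (-x) = X.norm x := by
  have := X.norm_smul (-1) x
  simpa using this

lemma norm_sub_comm (x y : MeasFun) : X.norm (x - y) = X.norm (y - x) := by
  rw [← X.norm_neg, neg_sub]

lemma norm_sum_le {ι : Type*} (F : Finset ι) (x : ι → MeasFun) :
    X.norm (∑ i ∈ F, x i) ≤ ∑ i ∈ F, X.norm (x i) := by
  classical
  induction F using Finset.induction_on with
  | empty => simp [X.norm_zero]
  | insert i F hi ih =>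
    rw [Finset.sum_insert hi, Finset.sum_insert hi]
    exact (X.norm_add_le _ _).trans (by gcongr)

lemma norm_sub_le (x y z : MeasFun) : X.norm (x - z) ≤ X.norm (x - y) + X.norm (y - z) := by
  rw [← sub_add_sub_cancel x y z]
  exact X.norm_add_le _ _

lemma norm_le_add (x y : MeasFun) : X.norm x ≤ X.norm y + X.norm (x - y) := by
  simpa [add_comm] using X.norm_add_le (x - y) y

/-- The norm is monotone with respect to comparison of distribution functions. -/
lemma norm_le_of_distribution_le {x y : MeasFun} (h : ∀ τ : ℝ, 0 < τ →
    (volume : Measure I) {t | τ < |x t|} ≤ (volume : Measure I) {t | τ < |y t|}) :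
    X.norm x ≤ X.norm y := by
  have hx := AEEqFun.measurable x
  have hy := AEEqFun.measurable y
  have hmx := measurable_decreasingRearrangement hx
  have hmy := measurable_decreasingRearrangement hy
  let x' : MeasFun := AEEqFun.mk _ hmx.aestronglyMeasurable
  let y' : MeasFun := AEEqFun.mk _ hmy.aestronglyMeasurable
  have ex : ∀ (z : MeasFun) (hz : Measurable z), X.norm z
      = X.norm (AEEqFun.mk _ (measurable_decreasingRearrangement hz).aestronglyMeasurable) := by
    intro z hz
    refine X.norm_eq_of_equimeasurable _ _ fun τ hτ => ?_
    rw [volume_congr_measFun (AEEqFun.coeFn_mk _ _) (fun r => τ < |r|),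
      ← volume_lt_decreasingRearrangement hz hτ.le]
    simp only [abs_of_nonneg (decreasingRearrangement_nonneg _)]
  rw [ex x hx, ex y hy]
  refine X.norm_mono _ _ ?_
  filter_upwards [AEEqFun.coeFn_mk _ hmx.aestronglyMeasurable (μ := (volume : Measure I)),
    AEEqFun.coeFn_mk _ hmy.aestronglyMeasurable (μ := (volume : Measure I)),
    ae_mem_Ioo_unitInterval] with t h1 h2 h3
  rw [h1, h2, abs_of_nonneg (decreasingRearrangement_nonneg _),
    abs_of_nonneg (decreasingRearrangement_nonneg _)]
  have ht : t ≠ 0 := fun h => by simp [h] at h3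
  by_contra! hlt
  have h4 := (lt_decreasingRearrangement_iff hx (decreasingRearrangement_nonneg _) ht).1 hlt
  refine lt_irrefl (decreasingRearrangement y t)
    ((lt_decreasingRearrangement_iff hy (decreasingRearrangement_nonneg _) ht).2 ?_)
  -- The hypothesis covers positive levels only. Level 0 is reached as the supremum over the levels
  -- `1 / (n + 1)`.
  rcases (decreasingRearrangement_nonneg t : 0 ≤ decreasingRearrangement y t).lt_or_eq with h5 | h5
  · exact h4.trans_le (h _ h5)
  · rw [← h5] at h4 ⊢
    have h6 : ∀ z : MeasFun, Measurable z → (volume : Measure I) {s | 0 < |z s|}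
        = ⨆ n : ℕ, (volume : Measure I) {s | 1 / ((n : ℝ) + 1) < |z s|} := by
      intro z hz
      rw [← Monotone.measure_iUnion]
      · congr 1
        ext s
        simp only [Set.mem_ofPred_eq, Set.mem_iUnion]
        constructor
        · exact exists_nat_one_div_lt
        · rintro ⟨n, hn⟩
          exact lt_trans (by positivity) hn
      · intro m n hmn s hs
        have : 1 / ((n : ℝ) + 1) ≤ 1 / ((m : ℝ) + 1) :=
          one_div_le_one_div_of_le (by positivity) (by simpa using hmn)
        exact this.trans_lt hs
    rw [h6 x hx] at h4
    rw [h6 y hy]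
    exact h4.trans_le (iSup_mono fun n => h _ (by positivity))

/-- Cut `[0,1]` into `N` intervals of length `1 / N`. On each, `δ` times the indicator is dominated
in distribution by `x`, and these `N` functions add up to `δ` almost everywhere. -/
lemma norm_one_le {x : MeasFun} {δ : ℝ} (hδ : 0 < δ) {N : ℕ}
    (hN : ENNReal.ofReal (1 / N) ≤ (volume : Measure I) {t | δ < |x t|}) (hN0 : 0 < N) :
    ENNReal.ofReal δ * X.norm 1 ≤ N * X.norm x := by
  let J : ℕ → Set I := fun k => {t | (k : ℝ) / N ≤ t ∧ (t : ℝ) < (k + 1) / N}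
  have hJ : ∀ k, MeasurableSet (J k) := fun k =>
    (measurableSet_le measurable_const measurable_subtype_coe).inter
      (measurableSet_lt measurable_subtype_coe measurable_const)
  let y : ℕ → MeasFun := fun k =>
    AEEqFun.mk ((J k).indicator fun _ => δ) (measurable_const.indicator (hJ k)).aestronglyMeasurable
  have hN' : (0 : ℝ) < N := by exact_mod_cast hN0
  have hy : ∀ k, X.norm (y k) ≤ X.norm x := by
    intro k
    refine X.norm_le_of_distribution_le fun τ hτ => ?_
    rw [volume_congr_measFun (AEEqFun.coeFn_mk _ _) (fun r => τ < |r|)]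
    by_cases h : τ < δ
    · refine le_trans ?_ (hN.trans (measure_mono fun t ht => h.trans ht))
      refine (measure_mono (t := J k) fun t ht => ?_).trans ?_
      · by_contra hn
        simp only [Set.mem_ofPred_eq, Set.indicator_of_notMem hn, abs_zero] at ht
        exact absurd ht (not_lt.2 hτ.le)
      · rw [unitInterval.volume_apply]
        refine (measure_mono (t := Set.Ico ((k : ℝ) / N) ((k + 1) / N)) ?_).trans ?_
        · rintro _ ⟨t, ht, rfl⟩
          exact ht
        · rw [Real.volume_Ico]
          apply ENNReal.ofReal_le_ofReal
          rw [← sub_div, add_sub_cancel_left]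
    · rw [measure_mono_null (t := ∅) (fun t ht => ?_) measure_empty]
      · exact zero_le
      · refine h (lt_of_lt_of_le ht ?_)
        by_cases hm : t ∈ J k
        · rw [Set.indicator_of_mem hm, abs_of_pos hδ]
        · rw [Set.indicator_of_notMem hm, abs_zero]; exact hδ.le
  have h1 : X.norm (δ • (1 : MeasFun)) ≤ X.norm (∑ k ∈ Finset.range N, y k) := by
    refine X.norm_mono _ _ ?_
    have e1 : (⇑(∑ k ∈ Finset.range N, y k)) =ᵐ[volume]
        fun t => ∑ k ∈ Finset.range N, (J k).indicator (fun _ => δ) t := by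
      have e2 : ∀ k ∈ Finset.range N, y k =ᵐ[volume] (J k).indicator (fun _ => δ) :=
        fun k _ => AEEqFun.coeFn_mk _ _
      have e3 := (AEEqFun.coeFn_finsetSum (Finset.range N) y)
      refine e3.trans ?_
      have e4 : ∀ᵐ t : I, ∀ k ∈ Finset.range N, y k t = (J k).indicator (fun _ => δ) t :=
        (Finset.eventually_all _).2 e2
      filter_upwards [e4] with t ht
      rw [Finset.sum_apply]
      exact Finset.sum_congr rfl ht
    filter_upwards [e1, AEEqFun.coeFn_smul δ (1 : MeasFun), AEEqFun.coeFn_one (β := ℝ) (α := I)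
      (μ := volume), ae_mem_Ioo_unitInterval] with t h1 h2 h3 h4
    rw [h1, h2, Pi.smul_apply, h3]
    simp only [Pi.one_apply, smul_eq_mul, mul_one]
    rw [abs_of_pos hδ]
    refine le_trans ?_ (le_abs_self _)
    have hk : ⌊(N : ℝ) * t⌋₊ ∈ Finset.range N := by
      rw [Finset.mem_range, Nat.floor_lt (by have := h4.1; positivity)]
      nlinarith [h4.2]
    refine le_trans ?_ (Finset.single_le_sum
      (f := fun k => (J k).indicator (fun _ => δ) t)
      (fun k _ => Set.indicator_nonneg (fun _ _ => hδ.le) _) hk)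
    have hm : t ∈ J ⌊(N : ℝ) * t⌋₊ := by
      constructor
      · rw [div_le_iff₀' hN']
        exact Nat.floor_le (by have := h4.1; positivity)
      · rw [lt_div_iff₀' hN']
        exact Nat.lt_floor_add_one _
    simp only [Set.indicator_of_mem hm, le_refl]
  rw [X.norm_smul, abs_of_pos hδ] at h1
  refine h1.trans ((X.norm_sum_le _ _).trans ((Finset.sum_le_sum fun k _ => hy k).trans ?_))
  simp

lemma eq_zero_of_volume_eq_zero {x : MeasFun}
    (h : ∀ δ : ℝ, 0 < δ → (volume : Measure I) {t | δ < |x t|} = 0) : x = 0 := by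
  have h1 : ∀ᵐ t : I, ∀ n : ℕ, |x t| ≤ 1 / ((n : ℝ) + 1) := by
    rw [ae_all_iff]
    intro n
    have := h (1 / ((n : ℝ) + 1)) (by positivity)
    rw [ae_iff]
    simpa only [not_le] using this
  refine AEEqFun.ext ?_
  filter_upwards [h1, AEEqFun.coeFn_zero (β := ℝ) (α := I) (μ := volume)] with t ht h0
  rw [h0]
  by_contra hne
  obtain ⟨n, hn⟩ := exists_nat_one_div_lt (abs_pos.2 hne)
  exact absurd (ht n) (not_le.2 hn)

lemma norm_one_lt_top : X.norm 1 < ∞ := by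
  obtain ⟨x, hx, hfin⟩ := X.nontrivial
  have : ∃ δ : ℝ, 0 < δ ∧ (volume : Measure I) {t | δ < |x t|} ≠ 0 := by
    by_contra! h
    exact hx (eq_zero_of_volume_eq_zero h)
  obtain ⟨δ, hδ, hv⟩ := this
  set v := (volume : Measure I) {t | δ < |x t|}
  have hv' : 0 < v.toReal := ENNReal.toReal_pos hv (measure_ne_top _ _)
  obtain ⟨n, hn⟩ := exists_nat_one_div_lt hv'
  have h1 := X.norm_one_le (x := x) hδ (N := n + 1) (by
    refine (ENNReal.ofReal_le_ofReal (by exact_mod_cast hn.le)).trans ?_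
    exact ENNReal.ofReal_toReal (measure_ne_top _ _) |>.le) n.succ_pos
  have h2 : ((n + 1 : ℕ) : ℝ≥0∞) * X.norm x < ∞ :=
    ENNReal.mul_lt_top (ENNReal.natCast_lt_top _) hfin
  by_contra h3
  rw [not_lt, top_le_iff] at h3
  rw [h3, ENNReal.mul_top (by simpa using hδ)] at h1
  exact absurd h2 (not_lt.2 h1)

lemma norm_one_ne_zero : X.norm 1 ≠ 0 := fun h => by
  have h1 := X.eq_zero_of_norm_eq_zero 1 h
  have h2 := AEEqFun.coeFn_one (β := ℝ) (α := I) (μ := volume)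
  rw [h1] at h2
  obtain ⟨t, h3, h4⟩ := (h2.and (AEEqFun.coeFn_zero (β := ℝ) (α := I) (μ := volume))).exists
  rw [h4] at h3
  simp at h3

/-- Weak-type embedding of `X` into the space of all measurable functions. -/
lemma mul_volume_le_norm (x : MeasFun) {δ : ℝ} (hδ : 0 < δ) :
    ENNReal.ofReal δ * (volume : Measure I) {t | δ < |x t|} * X.norm 1 ≤ 2 * X.norm x := by
  set v := (volume : Measure I) {t | δ < |x t|}
  have hvt : v ≠ ∞ := measure_ne_top _ _
  rcases eq_or_ne v 0 with hv | hv
  · simp [hv]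
  have hv' : 0 < v.toReal := ENNReal.toReal_pos hv hvt
  have hv1 : v.toReal ≤ 1 := by
    simpa using ENNReal.toReal_mono ENNReal.one_ne_top (prob_le_one : v ≤ 1)
  have hN0 : 0 < ⌈1 / v.toReal⌉₊ := Nat.ceil_pos.2 (by positivity)
  have hN1 : 1 / v.toReal ≤ ⌈1 / v.toReal⌉₊ := Nat.le_ceil _
  -- Rounding up at most doubles `1 / v` because `v ≤ 1`. This is the origin of the factor 2.
  have hN2 : (⌈1 / v.toReal⌉₊ : ℝ) ≤ 2 / v.toReal := by
    have := Nat.ceil_lt_add_one (a := 1 / v.toReal) (by positivity)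
    have h1 : 1 ≤ 1 / v.toReal := by rw [le_div_iff₀ hv']; linarith
    have h2 : 2 / v.toReal = 1 / v.toReal + 1 / v.toReal := by ring
    linarith
  set N := ⌈1 / v.toReal⌉₊
  have hN' : (0 : ℝ) < N := by exact_mod_cast hN0
  have h1 := X.norm_one_le (x := x) hδ (N := N) (by
    rw [ENNReal.ofReal_le_iff_le_toReal hvt, div_le_iff₀ hN']
    rwa [div_le_iff₀' hv'] at hN1) hN0
  have h2 : v * N ≤ 2 := by
    have : (v.toReal * N) ≤ 2 := by rwa [le_div_iff₀' hv'] at hN2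
    have h3 := ENNReal.ofReal_le_ofReal this
    rwa [ENNReal.ofReal_mul hv'.le, ENNReal.ofReal_toReal hvt, ENNReal.ofReal_natCast,
      ENNReal.ofReal_ofNat] at h3
  calc ENNReal.ofReal δ * v * X.norm 1 = v * (ENNReal.ofReal δ * X.norm 1) := by ring
    _ ≤ v * (N * X.norm x) := by gcongr
    _ = v * N * X.norm x := by ring
    _ ≤ 2 * X.norm x := by gcongr

lemma norm_le_of_ae_bound {x : MeasFun} {M : ℝ} (hM : 0 ≤ M) (h : ∀ᵐ t : I, |x t| ≤ M) :
    X.norm x ≤ ENNReal.ofReal M * X.norm 1 := by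
  have h1 : X.norm x ≤ X.norm (M • (1 : MeasFun)) := by
    refine X.norm_mono _ _ ?_
    filter_upwards [h, AEEqFun.coeFn_smul M (1 : MeasFun), AEEqFun.coeFn_one (β := ℝ) (α := I)
      (μ := volume)] with t h1 h2 h3
    rw [h2, Pi.smul_apply, h3]
    simpa [abs_of_nonneg hM] using h1
  rwa [X.norm_smul, abs_of_nonneg hM] at h1

lemma norm_lt_top_of_ae_bound {x : MeasFun} {M : ℝ} (h : ∀ᵐ t : I, |x t| ≤ M) :
    X.norm x < ∞ := by
  refine (X.norm_le_of_ae_bound (le_max_right M 0) ?_).trans_lt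
    (ENNReal.mul_lt_top ENNReal.ofReal_lt_top X.norm_one_lt_top)
  filter_upwards [h] with t ht
  exact ht.trans (le_max_left _ _)

/-- Limits in `X` are unique among limits in measure. -/
lemma eq_of_tendsto {f : ℕ → MeasFun} {x y : MeasFun}
    (hx : Tendsto (fun n => X.norm (f n - x)) atTop (𝓝 0))
    (hy : ∀ δ : ℝ, 0 < δ → Tendsto (fun n => (volume : Measure I) {t | δ < |(f n - y) t|}) atTop
      (𝓝 0)) : x = y := by
  rw [← sub_eq_zero]
  refine eq_zero_of_volume_eq_zero fun δ hδ => ?_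
  have hδ2 : 0 < δ / 2 := by positivity
  have h1 : Tendsto (fun n => (volume : Measure I) {t | δ / 2 < |(f n - x) t|}) atTop (𝓝 0) := by
    have hc : ENNReal.ofReal (δ / 2) * X.norm 1 ≠ 0 :=
      mul_ne_zero (by simpa using hδ) X.norm_one_ne_zero
    have hc' : ENNReal.ofReal (δ / 2) * X.norm 1 ≠ ∞ :=
      ENNReal.mul_ne_top ENNReal.ofReal_ne_top X.norm_one_lt_top.ne
    have h2 : Tendsto (fun n => (ENNReal.ofReal (δ / 2) * X.norm 1)⁻¹ *
        (2 * X.norm (f n - x))) atTop (𝓝 0) := by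
      have h3 := ENNReal.Tendsto.const_mul (a := 2) hx (Or.inr (by norm_num))
      have h4 := ENNReal.Tendsto.const_mul (a := (ENNReal.ofReal (δ / 2) * X.norm 1)⁻¹) h3
        (Or.inr (ENNReal.inv_ne_top.2 hc))
      simpa using h4
    refine tendsto_of_tendsto_of_tendsto_of_le_of_le tendsto_const_nhds h2
      (fun _ => zero_le) fun n => ?_
    have h3 := X.mul_volume_le_norm (f n - x) hδ2
    dsimp only
    rw [← ENNReal.div_eq_inv_mul, ENNReal.le_div_iff_mul_le (Or.inl hc) (Or.inl hc')]
    refine le_trans (le_of_eq ?_) h3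
    ring
  have h2 : ∀ n, (volume : Measure I) {t | δ < |(x - y) t|}
      ≤ (volume : Measure I) {t | δ / 2 < |(f n - x) t|}
        + (volume : Measure I) {t | δ / 2 < |(f n - y) t|} := by
    intro n
    refine (measure_mono_ae ?_).trans (measure_union_le _ _)
    filter_upwards [AEEqFun.coeFn_sub x y, AEEqFun.coeFn_sub (f n) y, AEEqFun.coeFn_sub (f n) x]
      with t h1 h2 h3 ht
    have ht' : δ < |(x - y) t| := ht
    change δ / 2 < |(f n - x) t| ∨ δ / 2 < |(f n - y) t|
    by_contra! hn
    rw [h1, Pi.sub_apply] at ht'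
    rw [h2, h3, Pi.sub_apply, Pi.sub_apply] at hn
    have : |x t - y t| ≤ |f n t - x t| + |f n t - y t| := by
      rw [abs_sub_comm (f n t) (x t)]
      exact abs_sub_le _ _ _
    linarith [hn.1, hn.2]
  have h3 := h1.add (hy _ hδ2)
  simp only [add_zero] at h3
  exact le_antisymm (ge_of_tendsto' h3 h2) zero_le

lemma limNorm_eq_norm {f : ℕ → MeasFun} {x : MeasFun} {N : ℕ} (h : ∀ n ≥ N, f n = x) :
    X.limNorm f = X.norm x := by
  unfold limNorm
  refine le_antisymm (iInf₂_le x ?_) (le_iInf₂ fun y hy => ?_)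
  · refine tendsto_const_nhds.congr' ?_
    filter_upwards [eventually_ge_atTop N] with n hn
    rw [h n hn, sub_self, X.norm_zero]
  · have h1 : Tendsto (fun _ : ℕ => X.norm (x - y)) atTop (𝓝 0) := by
      refine hy.congr' ?_
      filter_upwards [eventually_ge_atTop N] with n hn
      rw [h n hn]
    have h2 := tendsto_nhds_unique tendsto_const_nhds h1
    rw [sub_eq_zero.1 (X.eq_zero_of_norm_eq_zero _ h2)]

lemma norm_le_liminf {f : ℕ → MeasFun} {x : MeasFun}
    (hx : Tendsto (fun n => X.norm (f n - x)) atTop (𝓝 0)) :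
    X.norm x ≤ liminf (fun n => X.norm (f n)) atTop := by
  have h : ∀ ε : ℝ≥0∞, 0 < ε → X.norm x ≤ liminf (fun n => X.norm (f n)) atTop + ε := by
    intro ε hε
    have h1 : ∀ᶠ n in atTop, X.norm x - ε ≤ X.norm (f n) := by
      filter_upwards [hx.eventually (gt_mem_nhds hε)] with n hn
      rw [tsub_le_iff_right]
      refine (X.norm_le_add x (f n)).trans ?_
      rw [X.norm_sub_comm]
      gcongr
    rw [← tsub_le_iff_right]
    exact le_liminf_of_le (by isBoundedDefault) h1
  refine ENNReal.le_of_forall_pos_le_add fun ε hε _ => h ε (by exact_mod_cast hε)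

end SymmetricSpace

/-! ### The Orlicz space of `exp(t²) - 1` -/

/-- The modular `∫₀¹ (exp((x/l)²) - 1) dt`. -/
noncomputable def expModular (x : MeasFun) (l : ℝ) : ℝ≥0∞ :=
  ∫⁻ t : I, ENNReal.ofReal (Real.exp ((|x t| / l) ^ 2) - 1)

/-- Essential boundedness. -/
def EssBounded (x : MeasFun) : Prop := ∃ M : ℝ, ∀ᵐ t : I, |x t| ≤ M

lemma mem_Lp_top_iff_essBounded (x : MeasFun) :
    x ∈ Lp ℝ ∞ (volume : Measure I) ↔ EssBounded x := by
  rw [Lp.mem_Lp_iff_memLp]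
  constructor
  · intro h
    refine ⟨(eLpNorm x ∞ volume).toReal, ?_⟩
    have h1 := ae_le_eLpNormEssSup (f := x) (μ := (volume : Measure I))
    filter_upwards [h1] with t ht
    rw [eLpNorm_exponent_top, ← Real.norm_eq_abs, ← toReal_enorm]
    refine ENNReal.toReal_mono ?_ ht
    have := h.2.ne
    rwa [eLpNorm_exponent_top] at this
  · rintro ⟨M, hM⟩
    exact memLp_top_of_bound (AEEqFun.aestronglyMeasurable x) M hM

lemma EssBounded.sub {x y : MeasFun} (hx : EssBounded x) (hy : EssBounded y) :
    EssBounded (x - y) := by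
  obtain ⟨M, hM⟩ := hx
  obtain ⟨M', hM'⟩ := hy
  refine ⟨M + M', ?_⟩
  filter_upwards [hM, hM', AEEqFun.coeFn_sub x y] with t h1 h2 h3
  rw [h3, Pi.sub_apply]
  exact (abs_sub _ _).trans (add_le_add h1 h2)

lemma EssBounded.smul {x : MeasFun} (hx : EssBounded x) (c : ℝ) : EssBounded (c • x) := by
  obtain ⟨M, hM⟩ := hx
  refine ⟨|c| * M, ?_⟩
  filter_upwards [hM, AEEqFun.coeFn_smul c x] with t h1 h2
  rw [h2, Pi.smul_apply, smul_eq_mul, abs_mul]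
  gcongr

lemma EssBounded.sum {ι : Type*} (F : Finset ι) {x : ι → MeasFun}
    (hx : ∀ i ∈ F, EssBounded (x i)) : EssBounded (∑ i ∈ F, x i) := by
  classical
  induction F using Finset.induction_on with
  | empty =>
    refine ⟨0, ?_⟩
    filter_upwards [AEEqFun.coeFn_zero (β := ℝ) (α := I) (μ := volume)] with t ht
    simp [ht]
  | insert i F hi ih =>
    rw [Finset.sum_insert hi]
    obtain ⟨M, hM⟩ := hx i (by simp)
    obtain ⟨M', hM'⟩ := ih fun j hj => hx j (by simp [hj])
    refine ⟨M + M', ?_⟩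
    filter_upwards [hM, hM', AEEqFun.coeFn_add (x i) (∑ i ∈ F, x i)] with t h1 h2 h3
    rw [h3, Pi.add_apply]
    exact (abs_add_le _ _).trans (add_le_add h1 h2)

lemma measurable_expModular_integrand {α : Type*} [MeasurableSpace α] {f : α → ℝ} (hf : Measurable f) (l : ℝ) :
    Measurable fun t => ENNReal.ofReal (Real.exp ((|f t| / l) ^ 2) - 1) :=
  ((Real.measurable_exp.comp ((hf.abs.div_const l).pow_const 2)).sub_const 1).ennreal_ofReal

lemma orliczNorm_le {x : MeasFun} {l : ℝ} (hl : 0 < l) (h : expModular x l ≤ 1) :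
    orliczNorm (fun s => Real.exp (s ^ 2) - 1) x ≤ ENNReal.ofReal l :=
  sInf_le ⟨l, hl, rfl, h⟩

lemma exists_of_orliczNorm_lt {x : MeasFun} {c : ℝ≥0∞}
    (h : orliczNorm (fun s => Real.exp (s ^ 2) - 1) x < c) :
    ∃ l : ℝ, 0 < l ∧ ENNReal.ofReal l < c ∧ expModular x l ≤ 1 := by
  obtain ⟨_, ⟨l, hl, rfl, h1⟩, h2⟩ := sInf_lt_iff.1 h
  exact ⟨l, hl, h2, h1⟩

lemma expModular_anti {x : MeasFun} {l l' : ℝ} (hl : 0 < l) (h : l ≤ l') :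
    expModular x l' ≤ expModular x l := by
  have hl' : 0 < l' := hl.trans_le h
  unfold expModular
  gcongr

lemma expModular_smul (x : MeasFun) {c l : ℝ} (hc : 0 < c) :
    expModular (c • x) l = expModular x (l / c) := by
  refine lintegral_congr_ae ?_
  filter_upwards [AEEqFun.coeFn_smul c x] with t ht
  rw [ht, Pi.smul_apply, smul_eq_mul, abs_mul, abs_of_pos hc]
  congr 4
  field_simp

lemma expModular_lt_top {x : MeasFun} (hx : EssBounded x) {l : ℝ} (hl : 0 < l) :
    expModular x l < ∞ := by
  obtain ⟨M, hM⟩ := hx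
  calc expModular x l ≤ ∫⁻ _ : I, ENNReal.ofReal (Real.exp ((M / l) ^ 2) - 1) := by
        refine lintegral_mono_ae ?_
        filter_upwards [hM] with t ht
        gcongr
    _ < ∞ := by simp

/-- The modular is convex, in particular it decreases at least linearly under dilations. -/
lemma expModular_mul_le (x : MeasFun) {l c : ℝ} (hl : 0 < l) (hc : 1 ≤ c) :
    expModular x (c * l) ≤ ENNReal.ofReal (1 / c) * expModular x l := by
  have hc0 : 0 < c := by linarith
  unfold expModular
  rw [← lintegral_const_mul' _ _ ENNReal.ofReal_ne_top]
  refine lintegral_mono fun t => ?_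
  rw [← ENNReal.ofReal_mul (by positivity)]
  apply ENNReal.ofReal_le_ofReal
  set u := (|x t| / l) ^ 2
  have hu : 0 ≤ u := sq_nonneg _
  have hc1 : 1 / c ≤ 1 := by rw [div_le_one hc0]; exact hc
  have h1 : (|x t| / (c * l)) ^ 2 ≤ 1 / c * u := by
    have : (|x t| / (c * l)) ^ 2 = 1 / c * (1 / c * u) := by
      simp only [u]; field_simp
    rw [this]
    have h2 : 0 ≤ 1 / c := by positivity
    exact mul_le_mul_of_nonneg_left (mul_le_of_le_one_left hu hc1) h2
  have hconv := convexOn_exp.2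
  have h2 := hconv (Set.mem_univ 0) (Set.mem_univ u)
    (a := 1 - 1 / c) (b := 1 / c) (by linarith) (by positivity) (by ring)
  simp only [smul_eq_mul, mul_zero, zero_add, Real.exp_zero, mul_one] at h2
  have h3 := Real.exp_le_exp.2 h1
  linarith

/-- Convexity at the midpoint, in place of the triangle inequality for the Luxemburg norm. -/
lemma expModular_sub_le {x y z : MeasFun} {l : ℝ} (hl : 0 < l) (hy : expModular (x - y) l ≤ 1)
    (hz : expModular (x - z) l ≤ 1) : expModular (y - z) (2 * l) ≤ 1 := by
  have h1 : expModular (y - z) (2 * l)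
      ≤ ENNReal.ofReal (1 / 2) * (expModular (x - y) l + expModular (x - z) l) := by
    unfold expModular
    rw [← lintegral_add_left (measurable_expModular_integrand (AEEqFun.measurable _) l),
      ← lintegral_const_mul' _ _ ENNReal.ofReal_ne_top]
    refine lintegral_mono_ae ?_
    filter_upwards [AEEqFun.coeFn_sub x y, AEEqFun.coeFn_sub x z, AEEqFun.coeFn_sub y z]
      with t e1 e2 e3
    rw [e1, e2, e3, Pi.sub_apply, Pi.sub_apply, Pi.sub_apply]
    have hN : ∀ s : ℝ, 0 ≤ Real.exp (s ^ 2) - 1 := fun s => by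
      have := Real.one_le_exp (sq_nonneg s); linarith
    rw [← ENNReal.ofReal_add (hN _) (hN _), ← ENNReal.ofReal_mul (by norm_num)]
    apply ENNReal.ofReal_le_ofReal
    set a := |x t - y t| / l
    set b := |x t - z t| / l
    have h2 : |y t - z t| / (2 * l) ≤ (a + b) / 2 := by
      rw [← add_div, div_div, mul_comm l 2]
      gcongr
      have := abs_sub_le (y t) (x t) (z t)
      rwa [abs_sub_comm (y t) (x t)] at this
    have h3 : (|y t - z t| / (2 * l)) ^ 2 ≤ 1 / 2 * a ^ 2 + 1 / 2 * b ^ 2 := by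
      have h4 : (|y t - z t| / (2 * l)) ^ 2 ≤ ((a + b) / 2) ^ 2 :=
        pow_le_pow_left₀ (by positivity) h2 2
      nlinarith [sq_nonneg (a - b)]
    have hconv := convexOn_exp.2
    have h5 := hconv (Set.mem_univ (a ^ 2)) (Set.mem_univ (b ^ 2))
      (a := 1 / 2) (b := 1 / 2) (by norm_num) (by norm_num) (by norm_num)
    simp only [smul_eq_mul] at h5
    have h6 := Real.exp_le_exp.2 h3
    linarith
  refine h1.trans ((mul_le_mul_right (add_le_add hy hz) _).trans ?_)
  rw [one_add_one_eq_two, ← ENNReal.ofReal_ofNat 2, ← ENNReal.ofReal_mul (by norm_num)]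
  norm_num

/-- Markov's inequality for `exp ((x / l)²)`, whose integral is at most `1 + 1`. -/
lemma volume_lt_le_of_expModular_le {x : MeasFun} {l : ℝ} (hl : 0 < l) (h : expModular x l ≤ 1)
    {δ : ℝ} (hδ : 0 ≤ δ) :
    (volume : Measure I) {t | δ < |x t|} ≤ ENNReal.ofReal (2 * Real.exp (-(δ / l) ^ 2)) := by
  have hmeas : Measurable fun t : I => ENNReal.ofReal (Real.exp ((|x t| / l) ^ 2)) :=
    (Real.measurable_exp.comp
      (((AEEqFun.measurable x).abs.div_const l).pow_const 2)).ennreal_ofReal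
  have h1 := mul_meas_ge_le_lintegral (μ := (volume : Measure I)) hmeas
    (ENNReal.ofReal (Real.exp ((δ / l) ^ 2)))
  have h2 : ∫⁻ t : I, ENNReal.ofReal (Real.exp ((|x t| / l) ^ 2)) ≤ 2 := by
    calc ∫⁻ t : I, ENNReal.ofReal (Real.exp ((|x t| / l) ^ 2))
        ≤ ∫⁻ t : I, (ENNReal.ofReal (Real.exp ((|x t| / l) ^ 2) - 1) + 1) := by
          refine lintegral_mono fun t => ?_
          rw [← ENNReal.ofReal_one, ← ENNReal.ofReal_add (by
            have := Real.one_le_exp (sq_nonneg (|x t| / l)); linarith) (by norm_num)]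
          simp
      _ = expModular x l + 1 := by
          rw [lintegral_add_right _ measurable_const]
          simp [expModular]
      _ ≤ 2 := by
          rw [← one_add_one_eq_two]
          gcongr
  have h3 : (volume : Measure I) {t | δ < |x t|} ≤ (volume : Measure I)
      {t | ENNReal.ofReal (Real.exp ((δ / l) ^ 2)) ≤ ENNReal.ofReal (Real.exp ((|x t| / l) ^ 2))} := by
    refine measure_mono fun t ht => ?_
    have ht' : δ < |x t| := ht
    change ENNReal.ofReal _ ≤ ENNReal.ofReal _
    gcongr
  have h4 : ENNReal.ofReal (Real.exp ((δ / l) ^ 2)) * (volume : Measure I) {t | δ < |x t|} ≤ 2 :=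
    (mul_le_mul_right h3 _).trans (h1.trans h2)
  have h5 : 0 < Real.exp ((δ / l) ^ 2) := Real.exp_pos _
  have h6 : (volume : Measure I) {t | δ < |x t|} ≤ 2 / ENNReal.ofReal (Real.exp ((δ / l) ^ 2)) := by
    rw [ENNReal.le_div_iff_mul_le (Or.inl (by simpa using h5)) (Or.inl ENNReal.ofReal_ne_top),
      mul_comm]
    exact h4
  refine h6.trans (le_of_eq ?_)
  rw [Real.exp_neg, ← div_eq_mul_inv, ENNReal.ofReal_div_of_pos h5, ENNReal.ofReal_ofNat]

/-- Functions all of whose dilations have finite modular are limits of their truncations. -/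
lemma mem_spaceG {x : MeasFun} (h : ∀ l : ℝ, 0 < l → expModular x l < ∞) : x ∈ spaceG := by
  have hx := AEEqFun.measurable x
  refine ⟨?_, fun ε hε => ?_⟩
  · set c : ℝ := 1 + (expModular x 1).toReal
    have hc : 1 ≤ c := le_add_of_nonneg_right ENNReal.toReal_nonneg
    have h1 := expModular_mul_le x one_pos hc
    refine (orliczNorm_le (l := c * 1) (by linarith) (h1.trans ?_)).trans_lt ENNReal.ofReal_lt_top
    rw [← ENNReal.ofReal_toReal (h 1 one_pos).ne, ← ENNReal.ofReal_mul (by positivity),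
      ENNReal.ofReal_le_one, one_div, inv_mul_le_iff₀ (by linarith)]
    simp [c]
  · obtain ⟨l, hl, hlε⟩ : ∃ l : ℝ, 0 < l ∧ ENNReal.ofReal l < ε := by
      obtain ⟨r, hr, hrε⟩ := ENNReal.lt_iff_exists_nnreal_btwn.1 hε
      exact ⟨r, by exact_mod_cast hr, by simpa using hrε⟩
    let T : ℕ → Set I := fun n => {t | |x t| ≤ n}
    have hT : ∀ n, MeasurableSet (T n) := fun n => measurableSet_le hx.abs measurable_const
    let y : ℕ → MeasFun := fun n =>
      AEEqFun.mk ((T n).indicator x) (hx.indicator (hT n)).aestronglyMeasurable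
    have hy : ∀ n, y n =ᵐ[volume] (T n).indicator x := fun n => AEEqFun.coeFn_mk _ _
    have hlim : Tendsto (fun n => expModular (x - y n) l) atTop (𝓝 0) := by
      have hz : ∫⁻ _ : I, (0 : ℝ≥0∞) = 0 := lintegral_zero
      rw [← hz]
      refine tendsto_lintegral_of_dominated_convergence
        (fun t => ENNReal.ofReal (Real.exp ((|x t| / l) ^ 2) - 1))
        (fun n => measurable_expModular_integrand (AEEqFun.measurable _) l) (fun n => ?_)
        (h l hl).ne ?_
      · filter_upwards [hy n, AEEqFun.coeFn_sub x (y n)] with t h1 h2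
        rw [h2, Pi.sub_apply, h1]
        by_cases hm : t ∈ T n
        · rw [Set.indicator_of_mem hm]
          simp
        · rw [Set.indicator_of_notMem hm, sub_zero]
      · have h1 : ∀ᵐ t : I, ∀ n, y n t = (T n).indicator x t := ae_all_iff.2 hy
        have h2 : ∀ᵐ t : I, ∀ n, (x - y n) t = x t - y n t :=
          ae_all_iff.2 fun n => AEEqFun.coeFn_sub x (y n)
        filter_upwards [h1, h2] with t h1 h2
        refine tendsto_const_nhds.congr' ?_
        filter_upwards [eventually_ge_atTop ⌈|x t|⌉₊] with n hn
        have hm : t ∈ T n := Nat.ceil_le.1 hn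
        rw [h2, h1, Set.indicator_of_mem hm]
        simp
    obtain ⟨n, hn⟩ := (hlim.eventually (gt_mem_nhds one_pos)).exists
    refine ⟨y n, ?_, (orliczNorm_le hl hn.le).trans_lt hlε⟩
    rw [mem_Lp_top_iff_essBounded]
    refine ⟨n, ?_⟩
    filter_upwards [hy n] with t ht
    rw [ht]
    by_cases hm : t ∈ T n
    · rw [Set.indicator_of_mem hm]; exact hm
    · rw [Set.indicator_of_notMem hm]; simp

/-- If `z k` are bounded and their modulars decrease fast, then `sup |z k|` belongs to `G`. -/
lemma exists_mem_spaceG_ge {z : ℕ → MeasFun} (hb : ∀ k, EssBounded (z k))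
    (hz : ∀ k, expModular (z k) ((1 / 2) ^ k) ≤ 1) :
    ∃ x ∈ spaceG, ∀ k, ∀ᵐ t : I, |z k t| ≤ |x t| := by
  have hmz : ∀ k, Measurable fun t => |z k t| := fun k => (AEEqFun.measurable (z k)).abs
  have hmeas : Measurable fun t : I => ⨆ k, |z k t| := Measurable.iSup hmz
  -- Once `2 ^ (-K) < l`, convexity of the modular bounds the term of index `i + K` by `2 ^ (-i)`.
  -- The finitely many earlier terms are finite by boundedness.
  have hsum : ∀ l : ℝ, 0 < l → ∑' k, expModular (z k) l < ∞ := by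
    intro l hl
    obtain ⟨K, hK⟩ := exists_pow_lt_of_lt_one hl (by norm_num : (1 / 2 : ℝ) < 1)
    rw [← ENNReal.summable.sum_add_tsum_nat_add' (f := fun k => expModular (z k) l) (k := K)]
    refine ENNReal.add_lt_top.2 ⟨ENNReal.sum_lt_top.2 fun k _ => expModular_lt_top (hb k) hl, ?_⟩
    refine lt_of_le_of_lt (ENNReal.tsum_le_tsum (g := fun i => 2⁻¹ ^ i) fun i => ?_) (by
      rw [ENNReal.tsum_geometric]; simp)
    have h1 : (1 / 2 : ℝ) ^ (i + K) ≤ (1 / 2) ^ i * l := by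
      rw [pow_add]
      gcongr
    have h2 := expModular_mul_le (z (i + K)) (l := (1 / 2 : ℝ) ^ (i + K)) (c := 2 ^ i)
      (by positivity) (one_le_pow₀ (by norm_num))
    have h3 : (2 : ℝ) ^ i * (1 / 2) ^ (i + K) ≤ l := by
      calc (2 : ℝ) ^ i * (1 / 2) ^ (i + K) ≤ 2 ^ i * ((1 / 2) ^ i * l) := by gcongr
        _ = l := by rw [← mul_assoc, ← mul_pow]; norm_num
    calc expModular (z (i + K)) l ≤ expModular (z (i + K)) (2 ^ i * (1 / 2) ^ (i + K)) :=
          expModular_anti (by positivity) h3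
      _ ≤ ENNReal.ofReal (1 / 2 ^ i) * 1 := h2.trans (mul_le_mul_right (hz _) _)
      _ = 2⁻¹ ^ i := by
          rw [mul_one, one_div, ← inv_pow, ENNReal.ofReal_pow (by norm_num),
            ENNReal.ofReal_inv_of_pos (by norm_num), ENNReal.ofReal_ofNat]
  -- Inverting `exp (s²) - 1` bounds all `|z k t|` at once by the sum of the integrands, so the
  -- supremum is genuine wherever that sum is finite.
  have hpt : ∀ (l : ℝ), 0 < l → ∀ t : I,
      ∑' k, ENNReal.ofReal (Real.exp ((|z k t| / l) ^ 2) - 1) ≠ ∞ → ∀ k,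
      |z k t| ≤ l * √(Real.log (1 +
        (∑' k, ENNReal.ofReal (Real.exp ((|z k t| / l) ^ 2) - 1)).toReal)) := by
    intro l hl t ht k
    have h1 := ENNReal.toReal_mono ht (ENNReal.le_tsum k)
    rw [ENNReal.toReal_ofReal (by
      have := Real.one_le_exp (sq_nonneg (|z k t| / l)); linarith)] at h1
    rw [← div_le_iff₀' hl]
    refine Real.le_sqrt_of_sq_le ?_
    rw [Real.le_log_iff_exp_le (by positivity)]
    linarith
  have hmeas' : ∀ l : ℝ, ∀ k, Measurable fun t : I =>
      ENNReal.ofReal (Real.exp ((|z k t| / l) ^ 2) - 1) :=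
    fun l k => measurable_expModular_integrand (AEEqFun.measurable (z k)) l
  refine ⟨AEEqFun.mk _ hmeas.aestronglyMeasurable, mem_spaceG fun l hl => ?_, fun k => ?_⟩
  · refine lt_of_le_of_lt ?_ (hsum l hl)
    unfold expModular
    rw [← lintegral_tsum fun k => (hmeas' l k).aemeasurable]
    refine lintegral_mono_ae ?_
    filter_upwards [AEEqFun.coeFn_mk _ hmeas.aestronglyMeasurable (μ := (volume : Measure I))]
      with t ht
    rw [ht]
    set S := ∑' k, ENNReal.ofReal (Real.exp ((|z k t| / l) ^ 2) - 1)
    -- Where the series diverges the real supremum may take its default value, but the right-hand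
    -- side is `∞` there.
    rcases eq_or_ne S ∞ with hS | hS
    · rw [hS]; exact le_top
    have h0 : 0 ≤ ⨆ k, |z k t| := Real.iSup_nonneg fun k => abs_nonneg _
    have h1 : ⨆ k, |z k t| ≤ l * √(Real.log (1 + S.toReal)) := ciSup_le (hpt l hl t hS)
    rw [abs_of_nonneg h0, ← ENNReal.ofReal_toReal hS]
    apply ENNReal.ofReal_le_ofReal
    have h2 : (⨆ k, |z k t|) / l ≤ √(Real.log (1 + S.toReal)) := by rwa [div_le_iff₀' hl]
    have hS0 : 0 ≤ S.toReal := ENNReal.toReal_nonneg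
    have h3 : ((⨆ k, |z k t|) / l) ^ 2 ≤ Real.log (1 + S.toReal) := by
      refine (pow_le_pow_left₀ (by positivity) h2 2).trans (le_of_eq ?_)
      exact Real.sq_sqrt (Real.log_nonneg (by linarith))
    have h4 := Real.exp_le_exp.2 h3
    rw [Real.exp_log (by linarith)] at h4
    linarith
  · have h1 : ∀ᵐ t : I, ∑' k, ENNReal.ofReal (Real.exp ((|z k t| / 1) ^ 2) - 1) < ∞ := by
      refine ae_lt_top (Measurable.tsum (hmeas' 1)) ?_
      rw [lintegral_tsum fun k => (hmeas' 1 k).aemeasurable]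
      exact (hsum 1 one_pos).ne
    filter_upwards [h1, AEEqFun.coeFn_mk _ hmeas.aestronglyMeasurable
      (μ := (volume : Measure I))] with t h1 h2
    rw [h2]
    refine le_trans ?_ (le_abs_self _)
    exact le_ciSup (f := fun k => |z k t|) ⟨_, by rintro _ ⟨k, rfl⟩; exact hpt 1 one_pos t h1.ne k⟩ k

/-! ### Continuity of the inclusion of `G` into `X` -/

namespace SymmetricSpace

variable (X : SymmetricSpace)

/-- If `X ⊃ G`, then the inclusion is continuous. -/
lemma exists_norm_le_of_spaceG_subset (h : spaceG ⊆ X.carrier) :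
    ∃ C : ℝ≥0, ∀ (y : MeasFun) (l : ℝ), EssBounded y → 0 < l → expModular y l ≤ 1 →
      X.norm y ≤ C * ENNReal.ofReal l := by
  by_contra! hcon
  choose y l hy hl hyl hlt using fun k : ℕ => hcon (4 ^ k)
  have hc : ∀ k, 0 < (l k * 2 ^ k)⁻¹ := fun k => by have := hl k; positivity
  -- Gliding hump: dividing `y k` by `l k * 2 ^ k` makes its modular at level `2 ^ (-k)` at most 1.
  -- Of the factor `4 ^ k` there remains `2 ^ k`, so the common majorant in `G` has infinite norm in
  -- `X`.
  obtain ⟨x, hxG, hx⟩ := exists_mem_spaceG_ge (z := fun k => (l k * 2 ^ k)⁻¹ • y k)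
    (fun k => (hy k).smul _) fun k => by
      rw [expModular_smul _ (hc k)]
      refine le_trans (le_of_eq ?_) (hyl k)
      congr 1
      rw [div_inv_eq_mul, mul_comm (l k), ← mul_assoc, ← mul_pow]
      norm_num
  have hfin : X.norm x < ∞ := h hxG
  obtain ⟨n, hn⟩ := ENNReal.exists_nat_gt hfin.ne
  refine lt_irrefl (X.norm x) (hn.trans ?_)
  have h1 : ((2 ^ n : ℕ) : ℝ≥0∞) ≤ X.norm x := by
    refine le_trans ?_ (X.norm_mono _ _ (hx n))
    rw [X.norm_smul, abs_of_pos (hc n)]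
    calc ((2 ^ n : ℕ) : ℝ≥0∞) = ENNReal.ofReal (l n * 2 ^ n)⁻¹
          * ((4 ^ n : ℝ≥0) * ENNReal.ofReal (l n)) := by
          rw [← ENNReal.ofReal_coe_nnreal, ← ENNReal.ofReal_mul (by positivity),
            ← ENNReal.ofReal_mul (hc n).le, ← ENNReal.ofReal_natCast]
          congr 1
          have := (hl n).ne'
          push_cast
          rw [show (4 : ℝ) = 2 * 2 by norm_num, mul_pow]
          field_simp
      _ ≤ _ := by
          have := (hlt n).le
          gcongr
  refine lt_of_lt_of_le ?_ h1
  exact_mod_cast Nat.lt_two_pow_self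

/-- For an individual `u` the modular of the chaos need not be at most 1; only its average is. A
bound linear in the modular can be integrated over `u`. -/
lemma norm_le_mul_one_add_expModular {C : ℝ≥0}
    (hC : ∀ (y : MeasFun) (l : ℝ), EssBounded y → 0 < l → expModular y l ≤ 1 →
      X.norm y ≤ C * ENNReal.ofReal l) {y : MeasFun} (hy : EssBounded y) {l : ℝ} (hl : 0 < l) :
    X.norm y ≤ C * ENNReal.ofReal l * (1 + expModular y l) := by
  set E := expModular y l
  have hE : E ≠ ∞ := (expModular_lt_top hy hl).ne
  have hc : 1 ≤ 1 + E.toReal := le_add_of_nonneg_right ENNReal.toReal_nonneg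
  have h1 := hC y ((1 + E.toReal) * l) hy (by positivity) (by
    refine (expModular_mul_le y hl hc).trans ?_
    change _ * E ≤ 1
    rw [← ENNReal.ofReal_toReal hE, ← ENNReal.ofReal_mul (by positivity),
      ENNReal.ofReal_le_one, one_div, ENNReal.toReal_ofReal ENNReal.toReal_nonneg,
      inv_mul_le_iff₀ (by linarith)]
    linarith)
  refine h1.trans (le_of_eq ?_)
  rw [ENNReal.ofReal_mul (by positivity), ENNReal.ofReal_add (by norm_num) ENNReal.toReal_nonneg,
    ENNReal.ofReal_toReal hE, ENNReal.ofReal_one]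
  ring

/-- The converse: an estimate on bounded functions gives `X ⊃ G`. -/
lemma spaceG_subset_of_norm_le {C : ℝ≥0}
    (hC : ∀ (y : MeasFun) (l : ℝ), EssBounded y → 0 < l → expModular y l ≤ 1 →
      X.norm y ≤ C * ENNReal.ofReal l) : spaceG ⊆ X.carrier := by
  rintro x ⟨_, hx⟩
  have happ : ∀ n : ℕ, ∃ y : MeasFun, EssBounded y ∧ expModular (x - y) (1 / ((n : ℝ) + 1)) ≤ 1 := by
    intro n
    obtain ⟨y, hy, hlt⟩ := hx (ENNReal.ofReal (1 / ((n : ℝ) + 1)))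
      (ENNReal.ofReal_pos.2 (by positivity))
    obtain ⟨l, hl, hl1, hl2⟩ := exists_of_orliczNorm_lt hlt
    refine ⟨y, (mem_Lp_top_iff_essBounded y).1 hy, (expModular_anti hl ?_).trans hl2⟩
    exact ((ENNReal.ofReal_lt_ofReal_iff (by positivity)).1 hl1).le
  choose y hyb hy using happ
  have hmono : ∀ {m n : ℕ}, m ≤ n → 1 / ((n : ℝ) + 1) ≤ 1 / ((m : ℝ) + 1) := fun h =>
    one_div_le_one_div_of_le (by positivity) (by simpa using h)
  have hdiff : ∀ N m n : ℕ, N ≤ m → N ≤ n →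
      X.norm (y m - y n) ≤ C * ENNReal.ofReal (2 * (1 / ((N : ℝ) + 1))) := by
    intro N m n hm hn
    refine hC _ _ ((hyb m).sub (hyb n)) (by positivity) (expModular_sub_le (x := x) (by positivity)
      ((expModular_anti (by positivity) (hmono hm)).trans (hy m))
      ((expModular_anti (by positivity) (hmono hn)).trans (hy n)))
  have hlim : Tendsto (fun N : ℕ => (C : ℝ≥0∞) * ENNReal.ofReal (2 * (1 / ((N : ℝ) + 1)))) atTop
      (𝓝 0) := by
    have h1 : Tendsto (fun N : ℕ => 2 * (1 / ((N : ℝ) + 1))) atTop (𝓝 0) := by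
      simpa using (tendsto_one_div_add_atTop_nhds_zero_nat (𝕜 := ℝ)).const_mul 2
    have h2 := ENNReal.tendsto_ofReal h1
    simpa using ENNReal.Tendsto.const_mul (a := (C : ℝ≥0∞)) h2 (Or.inr ENNReal.coe_ne_top)
  obtain ⟨x', hx', hconv⟩ := X.complete y
    (fun n => by obtain ⟨M, hM⟩ := hyb n; exact X.norm_lt_top_of_ae_bound hM)
    (fun ε hε => by
      obtain ⟨N, hN⟩ := (hlim.eventually (gt_mem_nhds hε)).exists
      exact ⟨N, fun m hm n hn => (hdiff N m n hm hn).trans_lt hN⟩)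
  -- The bounded approximants are Cauchy in `X` and converge to `x` in measure, so their limit in
  -- `X` can only be `x`.
  have heq : x' = x := by
    refine X.eq_of_tendsto hconv fun δ hδ => ?_
    have h1 : ∀ n, (volume : Measure I) {t | δ < |(y n - x) t|}
        ≤ ENNReal.ofReal (2 * Real.exp (-(δ / (1 / ((n : ℝ) + 1))) ^ 2)) := by
      intro n
      refine le_trans (measure_mono_ae ?_)
        (volume_lt_le_of_expModular_le (by positivity) (hy n) hδ.le)
      filter_upwards [AEEqFun.coeFn_sub (y n) x, AEEqFun.coeFn_sub x (y n)] with t h1 h2 ht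
      have ht' : δ < |(y n - x) t| := ht
      change δ < |(x - y n) t|
      rwa [h2, Pi.sub_apply, abs_sub_comm, ← Pi.sub_apply, ← h1]
    refine tendsto_of_tendsto_of_tendsto_of_le_of_le tendsto_const_nhds ?_ (fun _ => zero_le) h1
    have h2 : Tendsto (fun n : ℕ => δ / (1 / ((n : ℝ) + 1))) atTop atTop := by
      simp only [div_div_eq_mul_div, div_one]
      exact (tendsto_atTop_add_const_right _ _ tendsto_natCast_atTop_atTop).const_mul_atTop hδ
    have h3 := Real.tendsto_exp_neg_atTop_nhds_zero.comp
      ((tendsto_pow_atTop (two_ne_zero)).comp h2)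
    have h4 := ENNReal.tendsto_ofReal (h3.const_mul 2)
    simpa [Function.comp_def] using h4
  rw [← heq]
  exact hx'

end SymmetricSpace

/-! ### Random Rademacher chaos -/

/-- The pairs `i < j < n`, written as `⟨j, i⟩`. -/
def pairsBelow (n : ℕ) : Finset (Σ _ : ℕ, ℕ) := (Finset.range n).sigma fun j => Finset.range j

lemma mem_pairsBelow {n : ℕ} {p : Σ _ : ℕ, ℕ} : p ∈ pairsBelow n ↔ p.1 < n ∧ p.2 < p.1 := by
  simp [pairsBelow]

lemma pairsBelow_mono {m n : ℕ} (h : m ≤ n) : pairsBelow m ⊆ pairsBelow n := fun p hp => by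
  rw [mem_pairsBelow] at hp ⊢
  exact ⟨hp.1.trans_le h, hp.2⟩

/-- The chaos `∑_{i < j < n} a_{ij} s_{e i j} r_i r_j` with prescribed signs. -/
noncomputable def signSum (e : ℕ → ℕ → ℕ) (a : ℕ → ℕ → ℝ) (n : ℕ) (s : ℕ → ℝ) : MeasFun :=
  ∑ p ∈ pairsBelow n, (a p.2 p.1 * s (e p.2 p.1)) • chaosFun p.2 p.1

/-- The largest index of the Rademacher functions occurring in the `n`-th partial sum. -/
def maxIndex (e : ℕ → ℕ → ℕ) (n : ℕ) : ℕ := (pairsBelow n).sup fun p => e p.2 p.1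

section Chaos

variable (e : ℕ → ℕ → ℕ) (a : ℕ → ℕ → ℝ) (n : ℕ)

lemma randomSum_eq_signSum (u : I) :
    randomSum e a n u = signSum e a n fun k => rademacher k u := by
  unfold randomSum signSum pairsBelow
  rw [Finset.sum_sigma]

lemma signSum_neg (s : ℕ → ℝ) : signSum e a n (-s) = -signSum e a n s := by
  simp [signSum]

variable {e n} in
lemma le_maxIndex {p : Σ _ : ℕ, ℕ} (hp : p ∈ pairsBelow n) : e p.2 p.1 ≤ maxIndex e n :=
  Finset.le_sup (f := fun p : Σ _ : ℕ, ℕ => e p.2 p.1) hp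

lemma maxIndex_mono {m n : ℕ} (h : m ≤ n) : maxIndex e m ≤ maxIndex e n :=
  Finset.sup_mono (pairsBelow_mono h)

lemma signSum_congr {s s' : ℕ → ℝ} (h : ∀ k ≤ maxIndex e n, s k = s' k) :
    signSum e a n s = signSum e a n s' :=
  Finset.sum_congr rfl fun p hp => by rw [h _ (le_maxIndex hp)]

lemma coeFn_chaosFun (i j : ℕ) :
    chaosFun i j =ᵐ[volume] fun t : I => rademacher i t * rademacher j t :=
  AEEqFun.coeFn_mk _ _

lemma signSum_coeFn (s : ℕ → ℝ) : ∀ᵐ t : I, signSum e a n s t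
    = ∑ p ∈ pairsBelow n, a p.2 p.1 * s (e p.2 p.1) * (rademacher p.2 t * rademacher p.1 t) := by
  have h1 : ∀ᵐ t : I, ∀ p ∈ pairsBelow n,
      ((a p.2 p.1 * s (e p.2 p.1)) • chaosFun p.2 p.1 : MeasFun) t
        = a p.2 p.1 * s (e p.2 p.1) * (rademacher p.2 t * rademacher p.1 t) := by
    refine (Finset.eventually_all _).2 fun p _ => ?_
    filter_upwards [AEEqFun.coeFn_smul (a p.2 p.1 * s (e p.2 p.1)) (chaosFun p.2 p.1),
      coeFn_chaosFun p.2 p.1] with t h1 h2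
    rw [h1, Pi.smul_apply, h2, smul_eq_mul]
  filter_upwards [h1, AEEqFun.coeFn_finsetSum (μ := (volume : Measure I)) (pairsBelow n) fun p =>
    (a p.2 p.1 * s (e p.2 p.1)) • chaosFun p.2 p.1] with t h1 h2
  unfold signSum
  rw [h2, Finset.sum_apply]
  exact Finset.sum_congr rfl h1

lemma abs_rademacher_le (k : ℕ) (t : ℝ) : |rademacher k t| ≤ 1 := by
  rcases rademacher_mem k t with h | h | h <;> rw [h] <;> simp

lemma essBounded_chaosFun (i j : ℕ) : EssBounded (chaosFun i j) := by
  refine ⟨1, ?_⟩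
  filter_upwards [coeFn_chaosFun i j] with t ht
  rw [ht, abs_mul]
  exact mul_le_one₀ (abs_rademacher_le _ _) (abs_nonneg _) (abs_rademacher_le _ _)

lemma essBounded_signSum (s : ℕ → ℝ) : EssBounded (signSum e a n s) :=
  EssBounded.sum _ fun _ _ => (essBounded_chaosFun _ _).smul _

lemma ae_abs_rademacher : ∀ᵐ t : I, ∀ k, |rademacher k t| = 1 := by
  classical
  rw [ae_all_iff]
  intro k
  have h1 := lintegral_rademacher_of_even k (fun s => if |s k| = 1 then 0 else 1)
    (fun s => by simp) (fun s s' h => by rw [h k le_rfl])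
  have h2 := measurable_comp_rademacher k (fun s => if |s k| = 1 then (0 : ℝ≥0∞) else 1)
    (fun s s' h => by rw [h k le_rfl])
  simp only [signSeq, abs_sgn, if_true, Finset.sum_const_zero, mul_zero] at h1
  rw [lintegral_eq_zero_iff h2] at h1
  filter_upwards [h1] with t ht
  by_contra h
  simp [h] at ht

/-- As a function of `u` the partial sum depends on finitely many Rademacher values, each from a
three-element set. Hence no measurability of `Φ`, in particular of the norm of `X`, is required. -/
lemma measurable_comp_randomSum {β : Type*} [MeasurableSpace β] (Φ : MeasFun → β) :
    Measurable fun u : I => Φ (randomSum e a n u) := by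
  simp only [randomSum_eq_signSum]
  exact measurable_comp_rademacher (maxIndex e n) (fun s => Φ (signSum e a n s))
    fun s s' h => by rw [signSum_congr e a n h]

lemma lintegral_randomSum {M : ℕ} (hM : maxIndex e n ≤ M) (Φ : MeasFun → ℝ≥0∞)
    (hΦ : ∀ x, Φ (-x) = Φ x) :
    ∫⁻ u : I, Φ (randomSum e a n u)
      = (2 ^ (M + 1))⁻¹ * ∑ ω : Fin (M + 1) → ℤˣ, Φ (signSum e a n (signSeq ω)) := by
  simp only [randomSum_eq_signSum]
  exact lintegral_rademacher_of_even M (fun s => Φ (signSum e a n s))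
    (fun s => by rw [signSum_neg, hΦ])
    fun s s' h => by rw [signSum_congr e a n fun k hk => h k (hk.trans hM)]

lemma ofNat_injOn {M : ℕ} : Set.InjOn (Fin.ofNat (M + 1)) {k | k ≤ M} := by
  intro k hk l hl h
  have h1 := congrArg Fin.val h
  simp only [Fin.val_ofNat] at h1
  rwa [Nat.mod_eq_of_lt (Nat.lt_succ_of_le hk), Nat.mod_eq_of_lt (Nat.lt_succ_of_le hl)] at h1

variable {e}

lemma injOn_pairsBelow (he : Set.InjOn (fun p : ℕ × ℕ => e p.1 p.2) {p | p.1 < p.2}) {M : ℕ}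
    (hM : maxIndex e n ≤ M) :
    Set.InjOn (fun p : Σ _ : ℕ, ℕ => Fin.ofNat (M + 1) (e p.2 p.1)) (pairsBelow n) := by
  rintro ⟨j, i⟩ hp ⟨j', i'⟩ hp' h
  have h1 := ofNat_injOn ((le_maxIndex hp).trans hM) ((le_maxIndex hp').trans hM) h
  have h2 : (i, j) = (i', j') := he (mem_pairsBelow.1 hp).2 (mem_pairsBelow.1 hp').2 h1
  simp only [Prod.mk.injEq] at h2
  rw [h2.1, h2.2]

/-- Fubini's theorem for the random chaos: for almost all `t` the average over `u` is an average
over a sum of independent signs with coefficients `± a_{ij}`. -/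
lemma lintegral_lintegral_randomSum {M : ℕ} (hM : maxIndex e n ≤ M) (Φ : ℝ → ℝ≥0∞)
    (hΦm : Measurable Φ) (hΦ : ∀ x, Φ (-x) = Φ x) :
    ∫⁻ u : I, ∫⁻ t : I, Φ (randomSum e a n u t)
      = ∫⁻ t : I, (2 ^ (M + 1))⁻¹ * ∑ ω : Fin (M + 1) → ℤˣ, Φ (∑ p ∈ pairsBelow n,
        a p.2 p.1 * (rademacher p.2 t * rademacher p.1 t)
          * sgn (ω (Fin.ofNat (M + 1) (e p.2 p.1)))) := by
  rw [lintegral_randomSum e a n hM (fun x => ∫⁻ t : I, Φ (x t)) fun x => by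
    refine lintegral_congr_ae ?_
    filter_upwards [AEEqFun.coeFn_neg x] with t ht
    rw [ht, Pi.neg_apply, hΦ]]
  have hm : ∀ ω ∈ (Finset.univ : Finset (Fin (M + 1) → ℤˣ)),
      Measurable fun t : I => Φ (signSum e a n (signSeq ω) t) :=
    fun ω _ => hΦm.comp (AEEqFun.measurable _)
  rw [← lintegral_finsetSum _ hm, ← lintegral_const_mul' _ _ (by simp)]
  refine lintegral_congr_ae ?_
  have h1 : ∀ᵐ t : I, ∀ ω : Fin (M + 1) → ℤˣ, signSum e a n (signSeq ω) t
      = ∑ p ∈ pairsBelow n, a p.2 p.1 * signSeq ω (e p.2 p.1)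
        * (rademacher p.2 t * rademacher p.1 t) :=
    ae_all_iff.2 fun ω => signSum_coeFn e a n _
  filter_upwards [h1] with t ht
  congr 1
  refine Finset.sum_congr rfl fun ω _ => ?_
  rw [ht]
  congr 1
  refine Finset.sum_congr rfl fun p _ => ?_
  simp only [signSeq]
  ring

lemma sum_sq_mul_rademacher {t : I} (ht : ∀ k, |rademacher k t| = 1) :
    ∑ p ∈ pairsBelow n, (a p.2 p.1 * (rademacher p.2 t * rademacher p.1 t)) ^ 2
      = ∑ p ∈ pairsBelow n, a p.2 p.1 ^ 2 := by
  refine Finset.sum_congr rfl fun p _ => ?_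
  rw [mul_pow, mul_pow, ← sq_abs (rademacher _ _), ht, ← sq_abs (rademacher _ _), ht]
  ring

lemma two_pow_inv_mul_le {M : ℕ} {r B : ℝ} (h : r ≤ 2 ^ (M + 1) * B) :
    ((2 : ℝ≥0∞) ^ (M + 1))⁻¹ * ENNReal.ofReal r ≤ ENNReal.ofReal B := by
  rw [← ENNReal.div_eq_inv_mul]
  refine ENNReal.div_le_of_le_mul' ?_
  rw [← ENNReal.ofReal_ofNat 2, ← ENNReal.ofReal_pow (by norm_num),
    ← ENNReal.ofReal_mul (by positivity)]
  exact ENNReal.ofReal_le_ofReal h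

lemma le_two_pow_inv_mul {M : ℕ} {r B : ℝ} (h : 2 ^ (M + 1) * B ≤ r) :
    ENNReal.ofReal B ≤ ((2 : ℝ≥0∞) ^ (M + 1))⁻¹ * ENNReal.ofReal r := by
  rw [← ENNReal.div_eq_inv_mul, ENNReal.le_div_iff_mul_le (Or.inl (by simp)) (Or.inl (by simp)),
    mul_comm]
  rw [← ENNReal.ofReal_ofNat 2, ← ENNReal.ofReal_pow (by norm_num),
    ← ENNReal.ofReal_mul (by positivity)]
  exact ENNReal.ofReal_le_ofReal h

/-- After Fubini, the subgaussian bound applies for almost every `t` with the same `τ`, since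
`|r_i(t) r_j(t)| = 1`. -/
lemma lintegral_expModular_randomSum_le
    (he : Set.InjOn (fun p : ℕ × ℕ => e p.1 p.2) {p | p.1 < p.2}) {τ : ℝ} (hτ : 0 < τ)
    (hV : ∑ p ∈ pairsBelow n, a p.2 p.1 ^ 2 ≤ τ ^ 2) :
    ∫⁻ u : I, expModular (randomSum e a n u) (3 * τ) ≤ 1 := by
  unfold expModular
  rw [lintegral_lintegral_randomSum a n (e := e) le_rfl
    (fun x => ENNReal.ofReal (Real.exp ((|x| / (3 * τ)) ^ 2) - 1))
    (measurable_expModular_integrand measurable_id _) (fun x => by rw [abs_neg])]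
  have h1 : ∫⁻ _ : I, (1 : ℝ≥0∞) = 1 := by simp
  rw [← h1]
  refine lintegral_mono_ae ?_
  filter_upwards [ae_abs_rademacher] with t ht
  have h2 := sum_cube_exp_sq_le _ (fun p : Σ _ : ℕ, ℕ =>
    a p.2 p.1 * (rademacher p.2 t * rademacher p.1 t)) _ (injOn_pairsBelow n he le_rfl) hτ
    (by rw [sum_sq_mul_rademacher a n ht]; exact hV)
  rw [← ENNReal.ofReal_sum_of_nonneg fun ω _ => by
    have := Real.one_le_exp (sq_nonneg (|∑ p ∈ pairsBelow n,
      a p.2 p.1 * (rademacher p.2 t * rademacher p.1 t)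
        * sgn (ω (Fin.ofNat (maxIndex e n + 1) (e p.2 p.1)))| / (3 * τ)))
    linarith]
  rw [← ENNReal.ofReal_one]
  apply two_pow_inv_mul_le
  rw [Finset.sum_sub_distrib]
  simp only [div_pow, sq_abs] at h2 ⊢
  simp only [Finset.sum_const, Finset.card_univ, nsmul_eq_mul, mul_one, card_cube]
  rw [Fintype.card_fin] at h2 ⊢
  linarith

/-- Paley–Zygmund for almost every `t`. Passing from `τ / 2` to `τ / 4` makes the inequality strict.
-/
lemma le_lintegral_volume_randomSum
    (he : Set.InjOn (fun p : ℕ × ℕ => e p.1 p.2) {p | p.1 < p.2}) {τ : ℝ} (hτ : 0 < τ)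
    (hV : ∑ p ∈ pairsBelow n, a p.2 p.1 ^ 2 = τ ^ 2) :
    ENNReal.ofReal (3 / 16) ≤
      ∫⁻ u : I, (volume : Measure I) {t | τ / 4 < |randomSum e a n u t|} := by
  have hset : MeasurableSet {x : ℝ | τ / 4 < |x|} :=
    measurableSet_lt measurable_const measurable_id.abs
  have h1 : ∀ u : I, (volume : Measure I) {t | τ / 4 < |randomSum e a n u t|}
      = ∫⁻ t : I, {x : ℝ | τ / 4 < |x|}.indicator 1 (randomSum e a n u t) := by
    intro u
    exact (lintegral_indicator_one (AEEqFun.measurable (randomSum e a n u) hset)).symm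
  simp only [h1]
  rw [lintegral_lintegral_randomSum a n (e := e) le_rfl _ (measurable_one.indicator hset)
    (fun x => by simp [Set.indicator])]
  have h2 : ∫⁻ _ : I, ENNReal.ofReal (3 / 16) = ENNReal.ofReal (3 / 16) := by simp
  rw [← h2]
  refine lintegral_mono_ae ?_
  filter_upwards [ae_abs_rademacher] with t ht
  have h3 := card_cube_abs_ge _ (fun p : Σ _ : ℕ, ℕ =>
    a p.2 p.1 * (rademacher p.2 t * rademacher p.1 t)) _ (injOn_pairsBelow n he le_rfl) hτ
    (by rw [sum_sq_mul_rademacher a n ht]; exact hV)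
  rw [Fintype.card_fin, mul_comm] at h3
  refine (le_two_pow_inv_mul h3).trans ?_
  gcongr
  rw [ENNReal.ofReal_natCast, Finset.card_eq_sum_ones, Nat.cast_sum, Finset.sum_filter]
  refine Finset.sum_le_sum fun ω _ => ?_
  split_ifs with h
  · rw [Set.indicator_of_mem (Set.mem_ofPred_eq.symm ▸ lt_of_lt_of_le (by linarith) h)]
    simp
  · exact zero_le

/-- With probability bounded below, the norm of the random chaos is at least of the order of its
`ℓ²`-norm. -/
lemma le_volume_norm_randomSum (X : SymmetricSpace)
    (he : Set.InjOn (fun p : ℕ × ℕ => e p.1 p.2) {p | p.1 < p.2}) {τ : ℝ} (hτ : 0 < τ)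
    (hV : ∑ p ∈ pairsBelow n, a p.2 p.1 ^ 2 = τ ^ 2) :
    ENNReal.ofReal (3 / 32) ≤ (volume : Measure I) {u | ENNReal.ofReal (τ / 4)
      * ENNReal.ofReal (3 / 32) * X.norm 1 ≤ 2 * X.norm (randomSum e a n u)} := by
  let g : I → ℝ≥0∞ := fun u => (volume : Measure I) {t | τ / 4 < |randomSum e a n u t|}
  have hg : Measurable g := measurable_comp_randomSum e a n
    fun x => (volume : Measure I) {t | τ / 4 < |x t|}
  have h1 : ENNReal.ofReal (3 / 16) ≤ ∫⁻ u, g u := le_lintegral_volume_randomSum a n he hτ hV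
  have hset : MeasurableSet {u | ENNReal.ofReal (3 / 32) ≤ g u} :=
    measurableSet_le measurable_const hg
  -- Since `g ≤ 1` has integral at least `3/16`, it must be at least `3/32` on a set of measure at
  -- least `3/32`.
  have h2 : ∫⁻ u, g u ≤ (volume : Measure I) {u | ENNReal.ofReal (3 / 32) ≤ g u}
      + ENNReal.ofReal (3 / 32) := by
    rw [← lintegral_indicator_one hset]
    have h3 : ∫⁻ _ : I, ENNReal.ofReal (3 / 32) = ENNReal.ofReal (3 / 32) := by simp
    refine le_of_le_of_eq (lintegral_mono (g := fun u =>
      {u | ENNReal.ofReal (3 / 32) ≤ g u}.indicator 1 u + ENNReal.ofReal (3 / 32)) fun u => ?_)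
      (by rw [lintegral_add_right _ measurable_const, h3])
    dsimp only
    by_cases h : ENNReal.ofReal (3 / 32) ≤ g u
    · rw [Set.indicator_of_mem (show u ∈ {u | ENNReal.ofReal (3 / 32) ≤ g u} from h)]
      exact le_add_right prob_le_one
    · exact le_add_left (not_le.1 h).le
  have h3 : ENNReal.ofReal (3 / 16) = ENNReal.ofReal (3 / 32) + ENNReal.ofReal (3 / 32) := by
    rw [← ENNReal.ofReal_add (by norm_num) (by norm_num)]; norm_num
  rw [h3] at h1
  refine (ENNReal.le_of_add_le_add_right ENNReal.ofReal_ne_top (h1.trans h2)).trans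
    (measure_mono fun u hu => ?_)
  have hu' : ENNReal.ofReal (3 / 32) ≤ g u := hu
  refine le_trans ?_ (X.mul_volume_le_norm (randomSum e a n u) (by positivity : 0 < τ / 4))
  gcongr

lemma l2NormUpTo_eq : l2NormUpTo a n = ENNReal.ofReal √(∑ p ∈ pairsBelow n, a p.2 p.1 ^ 2) := by
  unfold l2NormUpTo pairsBelow
  rw [Real.sqrt_eq_rpow, ← ENNReal.ofReal_rpow_of_nonneg
    (Finset.sum_nonneg fun _ _ => sq_nonneg _) (by norm_num),
    ENNReal.ofReal_sum_of_nonneg fun _ _ => sq_nonneg _, Finset.sum_sigma]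

end Chaos

/-! ### Finite sums -/

lemma randomSum_eq_zero (e : ℕ → ℕ → ℕ) {a : ℕ → ℕ → ℝ} {n : ℕ}
    (h : ∑ p ∈ pairsBelow n, a p.2 p.1 ^ 2 = 0) (u : I) : randomSum e a n u = 0 := by
  rw [randomSum_eq_signSum]
  refine Finset.sum_eq_zero fun p hp => ?_
  rw [Finset.sum_eq_zero_iff_of_nonneg fun _ _ => sq_nonneg _] at h
  rw [pow_eq_zero_iff two_ne_zero |>.1 (h p hp)]
  simp

section Estimates

variable (X : SymmetricSpace) {e : ℕ → ℕ → ℕ}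

lemma measurable_norm_randomSum (e : ℕ → ℕ → ℕ) (a : ℕ → ℕ → ℝ) (n : ℕ) :
    Measurable fun u : I => X.norm (randomSum e a n u) :=
  measurable_comp_randomSum e a n X.norm

/-- Markov's inequality on the event of `le_volume_norm_randomSum`; the constant is `1/2 · 1/4 ·
(3/32)²`. -/
lemma mul_l2NormUpTo_le_lintegral (he : Set.InjOn (fun p : ℕ × ℕ => e p.1 p.2) {p | p.1 < p.2})
    (a : ℕ → ℕ → ℝ) (n : ℕ) :
    ENNReal.ofReal (9 / 8192) * X.norm 1 * l2NormUpTo a n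
      ≤ ∫⁻ u : I, X.norm (randomSum e a n u) := by
  rw [l2NormUpTo_eq]
  set V := ∑ p ∈ pairsBelow n, a p.2 p.1 ^ 2
  have hV : 0 ≤ V := Finset.sum_nonneg fun _ _ => sq_nonneg _
  rcases hV.eq_or_lt with h0 | h0
  · rw [← h0]
    simp
  have hτ : 0 < √V := Real.sqrt_pos.2 h0
  have h1 := le_volume_norm_randomSum a n X he hτ (Real.sq_sqrt hV).symm
  have h2 := mul_meas_ge_le_lintegral (μ := (volume : Measure I))
    ((measurable_norm_randomSum X e a n).const_mul 2)
    (ENNReal.ofReal (√V / 4) * ENNReal.ofReal (3 / 32) * X.norm 1)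
  rw [lintegral_const_mul _ (measurable_norm_randomSum X e a n)] at h2
  have h3 := (mul_le_mul_right h1 _).trans h2
  refine (ENNReal.mul_le_mul_iff_right (a := 2) (by norm_num) (by norm_num)).1 (le_trans ?_ h3)
  have h4 : ENNReal.ofReal (√V / 4) * ENNReal.ofReal (3 / 32) * ENNReal.ofReal (3 / 32)
      = 2 * (ENNReal.ofReal (9 / 8192) * ENNReal.ofReal √V) := by
    rw [← ENNReal.ofReal_ofNat 2, ← ENNReal.ofReal_mul (by positivity),
      ← ENNReal.ofReal_mul (by positivity), ← ENNReal.ofReal_mul (by positivity),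
      ← ENNReal.ofReal_mul (by positivity)]
    congr 1
    ring
  calc 2 * (ENNReal.ofReal (9 / 8192) * X.norm 1 * ENNReal.ofReal √V)
      = 2 * (ENNReal.ofReal (9 / 8192) * ENNReal.ofReal √V) * X.norm 1 := by ring
    _ = ENNReal.ofReal (√V / 4) * ENNReal.ofReal (3 / 32) * ENNReal.ofReal (3 / 32)
        * X.norm 1 := by rw [h4]
    _ = _ := by ring
    _ ≤ _ := le_rfl

lemma lintegral_norm_randomSum_le
    (he : Set.InjOn (fun p : ℕ × ℕ => e p.1 p.2) {p | p.1 < p.2}) {C : ℝ≥0}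
    (hC : ∀ (y : MeasFun) (l : ℝ), EssBounded y → 0 < l → expModular y l ≤ 1 →
      X.norm y ≤ C * ENNReal.ofReal l) (a : ℕ → ℕ → ℝ) (n : ℕ) :
    ∫⁻ u : I, X.norm (randomSum e a n u) ≤ 6 * C * l2NormUpTo a n := by
  rw [l2NormUpTo_eq]
  set V := ∑ p ∈ pairsBelow n, a p.2 p.1 ^ 2 with hVdef
  have hV : 0 ≤ V := Finset.sum_nonneg fun _ _ => sq_nonneg _
  rcases hV.eq_or_lt with h0 | h0
  · simp [randomSum_eq_zero e h0.symm, X.norm_zero]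
  have hτ : 0 < √V := Real.sqrt_pos.2 h0
  have h1 := lintegral_expModular_randomSum_le a n he hτ (Real.sq_sqrt hV).ge
  calc ∫⁻ u : I, X.norm (randomSum e a n u)
      ≤ ∫⁻ u : I, C * ENNReal.ofReal (3 * √V) * (1 + expModular (randomSum e a n u) (3 * √V)) := by
        refine lintegral_mono fun u => ?_
        refine X.norm_le_mul_one_add_expModular hC ?_ (by positivity)
        rw [randomSum_eq_signSum]
        exact essBounded_signSum e a n _
    _ = C * ENNReal.ofReal (3 * √V)
        * (1 + ∫⁻ u : I, expModular (randomSum e a n u) (3 * √V)) := by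
        rw [lintegral_const_mul' _ _ (ENNReal.mul_ne_top ENNReal.coe_ne_top
          ENNReal.ofReal_ne_top), lintegral_add_left measurable_const]
        simp
    _ ≤ C * ENNReal.ofReal (3 * √V) * (1 + 1) := by gcongr
    _ = 6 * C * ENNReal.ofReal √V := by
        rw [ENNReal.ofReal_mul (by norm_num), ENNReal.ofReal_ofNat, one_add_one_eq_two]
        ring

/-- Comparison of a function with Gaussian tails with one whose tails are bounded below. -/
lemma norm_le_of_tail_ge {y z : MeasFun} {J : ℕ}
    (hy : ∀ i ≤ J, ENNReal.ofReal ((3 / 32) ^ (4 ^ i))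
      ≤ (volume : Measure I) {t | (2 : ℝ) ^ i * 2 ^ J / 2 ≤ |y t|})
    (hz : expModular z 1 ≤ 1) (hzb : ∀ᵐ t : I, |z t| ≤ 4 * 2 ^ J) :
    X.norm z ≤ 4 * X.norm 1 + ENNReal.ofReal (8 / 2 ^ J) * X.norm y := by
  -- Lowering `|z|` by 4 costs `4 * X.norm 1` and leaves a tail at `τ` of at most `2 exp (-(τ +
  -- 4)²)`, which is small enough even for `τ` near 0.
  have hm : Measurable fun t : I => max (|z t| - 4) 0 :=
    ((AEEqFun.measurable z).abs.sub_const 4).max measurable_const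
  let w : MeasFun := AEEqFun.mk _ hm.aestronglyMeasurable
  have hw : w =ᵐ[volume] fun t => max (|z t| - 4) 0 := AEEqFun.coeFn_mk _ _
  have h1 : X.norm z ≤ X.norm ((4 : ℝ) • (1 : MeasFun) + w) := by
    refine X.norm_mono _ _ ?_
    filter_upwards [hw, AEEqFun.coeFn_add ((4 : ℝ) • (1 : MeasFun)) w,
      AEEqFun.coeFn_smul (4 : ℝ) (1 : MeasFun), AEEqFun.coeFn_one (β := ℝ) (α := I)
      (μ := volume)] with t h1 h2 h3 h4
    rw [h2, Pi.add_apply, h1, h3, Pi.smul_apply, h4]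
    simp only [Pi.one_apply, smul_eq_mul, mul_one]
    refine le_trans ?_ (le_abs_self _)
    linarith [le_max_left (|z t| - 4) 0]
  have h2 : X.norm w ≤ X.norm ((8 / 2 ^ J : ℝ) • y) := by
    refine X.norm_le_of_distribution_le fun τ hτ => ?_
    rw [volume_congr_measFun hw (fun r => τ < |r|),
      volume_congr_measFun (AEEqFun.coeFn_smul _ y) (fun r => τ < |r|)]
    have hsub : {t : I | τ < |max (|z t| - 4) 0|} ⊆ {t : I | τ + 4 < |z t|} := by
      intro t ht
      have ht' : τ < |max (|z t| - 4) 0| := ht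
      rw [abs_of_nonneg (le_max_right _ _), lt_max_iff] at ht'
      change τ + 4 < |z t|
      rcases ht' with h | h <;> linarith
    refine (measure_mono hsub).trans ?_
    by_cases hbig : 4 * 2 ^ J ≤ τ
    · rw [measure_mono_null (t := {t : I | ¬ |z t| ≤ 4 * 2 ^ J}) (fun t ht => ?_) (ae_iff.1 hzb)]
      · exact zero_le
      · have ht' : τ + 4 < |z t| := ht
        change ¬ _
        linarith
    -- The least such `i` satisfies `4 ^ (i + 1) ≤ (τ + 4)²`, so the tail is at most `(2 exp (-4)) ^
    -- (4 ^ i)`, and `2 exp (-4) ≤ 3/32`.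
    · have hex : ∃ i, τ < 4 * 2 ^ i := ⟨J, not_le.1 hbig⟩
      classical
      have hi := Nat.find_spec hex
      have hmin := fun j (hj : j < Nat.find hex) => Nat.find_min hex hj
      have hiJ : Nat.find hex ≤ J := Nat.find_min' hex (not_le.1 hbig)
      set i := Nat.find hex
      have hsq : 4 * 4 ^ i ≤ (τ + 4) ^ 2 := by
        rcases Nat.eq_zero_or_pos i with h0 | h0
        · rw [h0]; nlinarith
        · obtain ⟨j, hj⟩ : ∃ j, i = j + 1 := ⟨i - 1, by omega⟩
          have h3 := not_lt.1 (hmin j (by omega))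
          have h4 : (4 * 2 ^ j) ^ 2 ≤ τ ^ 2 := pow_le_pow_left₀ (by positivity) h3 2
          have h5 : (4 : ℝ) * 4 ^ i = (4 * 2 ^ j) ^ 2 := by
            rw [hj, mul_pow, ← pow_mul, mul_comm j 2, pow_mul, pow_succ]; norm_num; ring
          rw [h5]
          nlinarith
      have hexp : 2 * Real.exp (-((τ + 4) / 1) ^ 2) ≤ (3 / 32) ^ (4 ^ i) := by
        have h3 : Real.exp (-((τ + 4) / 1) ^ 2) ≤ Real.exp (-4) ^ (4 ^ i) := by
          rw [← Real.exp_nat_mul, Real.exp_le_exp, div_one]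
          push_cast
          linarith
        have h4 : 2 * Real.exp (-4) ≤ 3 / 32 := by
          have h5 : (2.7 : ℝ) ^ 4 ≤ Real.exp 4 := by
            have h6 := Real.exp_one_gt_d9
            have h7 : Real.exp 4 = Real.exp 1 ^ 4 := by rw [← Real.exp_nat_mul]; norm_num
            rw [h7]
            exact pow_le_pow_left₀ (by norm_num) (by linarith) 4
          rw [Real.exp_neg, ← div_eq_mul_inv, div_le_iff₀ (Real.exp_pos 4)]
          norm_num at h5 ⊢
          linarith
        calc 2 * Real.exp (-((τ + 4) / 1) ^ 2) ≤ 2 * Real.exp (-4) ^ (4 ^ i) := by gcongr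
          _ ≤ 2 ^ (4 ^ i) * Real.exp (-4) ^ (4 ^ i) := by
            gcongr
            exact le_self_pow₀ (by norm_num) (by positivity)
          _ = (2 * Real.exp (-4)) ^ (4 ^ i) := by rw [mul_pow]
          _ ≤ _ := pow_le_pow_left₀ (by positivity) h4 _
      refine (volume_lt_le_of_expModular_le one_pos hz (by linarith)).trans
        ((ENNReal.ofReal_le_ofReal hexp).trans ((hy i hiJ).trans (measure_mono fun t ht => ?_)))
      have ht' : (2 : ℝ) ^ i * 2 ^ J / 2 ≤ |y t| := ht
      change τ < |((8 / 2 ^ J : ℝ) • ⇑y) t|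
      rw [Pi.smul_apply, smul_eq_mul, abs_mul, abs_of_pos (by positivity)]
      refine hi.trans_le ?_
      calc (4 : ℝ) * 2 ^ i = 8 / 2 ^ J * (2 ^ i * 2 ^ J / 2) := by field_simp; norm_num
        _ ≤ _ := by gcongr
  refine h1.trans ((X.norm_add_le _ _).trans (add_le_add (le_of_eq ?_) (h2.trans (le_of_eq ?_))))
  · rw [X.norm_smul]; simp
  · rw [X.norm_smul, abs_of_pos (by positivity)]

/-- The coefficients of the sums `∑_j r_0 r_j`. -/
def rowCoeff (i _j : ℕ) : ℝ := if i = 0 then 1 else 0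

lemma sum_pairsBelow_row (K : ℕ) (f : ℕ → ℕ → ℝ) :
    ∑ p ∈ pairsBelow (K + 1), rowCoeff p.2 p.1 * f p.2 p.1
      = ∑ k : Fin K, f 0 (k + 1) := by
  unfold pairsBelow rowCoeff
  rw [Finset.sum_sigma, Finset.sum_range_succ']
  simp only [Finset.range_zero, Finset.sum_empty, add_zero]
  rw [Finset.sum_range]
  refine Finset.sum_congr rfl fun k _ => ?_
  simp

lemma l2NormUpTo_rowCoeff (J : ℕ) : l2NormUpTo rowCoeff (4 ^ J + 1) = 2 ^ J := by
  have h1 : ∑ p ∈ pairsBelow (4 ^ J + 1), rowCoeff p.2 p.1 ^ 2 = (2 ^ J) ^ 2 := by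
    have h := sum_pairsBelow_row (4 ^ J) fun i j => rowCoeff i j
    simp only [← sq] at h
    rw [h]
    simp [rowCoeff, ← pow_mul, mul_comm J 2]
    rw [pow_mul]
    norm_num
  rw [l2NormUpTo_eq, h1, Real.sqrt_sq (by positivity), ENNReal.ofReal_pow (by norm_num),
    ENNReal.ofReal_ofNat]

/-- For fixed `u` the random signs are absorbed by the symmetry of `(r_1, …, r_K)`, and `|r_0| = 1`.
The distribution is that of `|r_1 + … + r_K|`, to which `card_cube_tail` applies. -/
lemma le_volume_rowSum (e : ℕ → ℕ → ℕ) {u : I} (hu : ∀ k, |rademacher k u| = 1) {i J : ℕ}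
    (hi : i ≤ J) : ENNReal.ofReal ((3 / 32) ^ (4 ^ i)) ≤ (volume : Measure I)
      {t | (2 : ℝ) ^ i * 2 ^ J / 2 ≤ |randomSum e rowCoeff (4 ^ J + 1) u t|} := by
  classical
  obtain ⟨m, rfl⟩ := Nat.exists_eq_add_of_le hi
  set K := 4 ^ (i + m)
  set τ : ℝ := 2 ^ (2 * i + m) / 2
  have hη : ∀ k : Fin K, ∃ b : ℤˣ, sgn b = rademacher (e 0 (k + 1)) u := by
    intro k
    rcases eq_or_eq_neg_of_abs_eq (hu (e 0 (k + 1))) with h | h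
    · exact ⟨1, by simp [h]⟩
    · exact ⟨-1, by simp [h]⟩
  choose η hη using hη
  have h1 := lintegral_rademacher_succ K fun v =>
    if τ ≤ |∑ k : Fin K, sgn (η k) * v k| then 1 else 0
  have h2 : (∑ ω : Fin K → ℤˣ, if τ ≤ |∑ k : Fin K, sgn (η k) * sgn (ω k)| then (1 : ℝ≥0∞) else 0)
      = (Finset.univ.filter fun ω : Fin K → ℤˣ => τ ≤ |∑ k, sgn (ω k)|).card := by
    rw [Finset.card_eq_sum_ones, Nat.cast_sum, Finset.sum_filter, ← sum_cube_mul η]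
    refine Finset.sum_congr rfl fun ω _ => ?_
    simp only [Pi.mul_apply, sgn_mul, ← mul_assoc, sgn_mul_self, one_mul]
    simp
  rw [h2] at h1
  have h3 : ENNReal.ofReal ((3 / 32) ^ (4 ^ i)) ≤ (2 ^ K)⁻¹
      * ((Finset.univ.filter fun ω : Fin K → ℤˣ => τ ≤ |∑ k, sgn (ω k)|).card : ℝ≥0∞) := by
    have h4 := card_cube_tail i m
    have h5 : ((Finset.univ.filter fun ω : Fin K → ℤˣ => τ ≤ ∑ k, sgn (ω k)).card : ℝ≥0∞)
        ≤ (Finset.univ.filter fun ω : Fin K → ℤˣ => τ ≤ |∑ k, sgn (ω k)|).card := by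
      refine Nat.cast_le.2 (Finset.card_le_card fun ω hω => ?_)
      simp only [Finset.mem_filter, Finset.mem_univ, true_and] at hω ⊢
      exact hω.trans (le_abs_self _)
    refine le_trans ?_ (mul_le_mul_right h5 _)
    rw [← ENNReal.div_eq_inv_mul, ENNReal.le_div_iff_mul_le (Or.inl (by simp)) (Or.inl (by simp)),
      ← ENNReal.ofReal_ofNat 2, ← ENNReal.ofReal_pow (by norm_num),
      ← ENNReal.ofReal_mul (by positivity), ← ENNReal.ofReal_natCast]
    exact ENNReal.ofReal_le_ofReal h4
  rw [← h1] at h3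
  refine h3.trans ?_
  have hτ : (2 : ℝ) ^ i * 2 ^ (i + m) / 2 = τ := by simp only [τ]; ring
  have hmeas : MeasurableSet {t : I | τ ≤ |randomSum e rowCoeff (K + 1) u t|} :=
    measurableSet_le measurable_const (AEEqFun.measurable _).abs
  rw [hτ, ← lintegral_indicator_one hmeas]
  refine lintegral_mono_ae ?_
  have h6 := signSum_coeFn e rowCoeff (K + 1) fun k => rademacher k u
  rw [← randomSum_eq_signSum] at h6
  filter_upwards [h6, ae_abs_rademacher] with t ht hr
  simp only [mul_assoc] at ht
  rw [sum_pairsBelow_row K fun i j =>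
    rademacher (e i j) u * (rademacher i t * rademacher j t)] at ht
  have h7 : |randomSum e rowCoeff (K + 1) u t|
      = |∑ k : Fin K, sgn (η k) * rademacher (k + 1) t| := by
    rw [ht]
    simp only [hη, mul_left_comm _ (rademacher 0 t)]
    rw [← Finset.mul_sum, abs_mul, hr, one_mul]
  split_ifs with h
  · rw [← h7] at h
    rw [Set.indicator_of_mem (Set.mem_ofPred_eq.symm ▸ h)]
    simp
  · exact zero_le

/-- Some `u` has norm at most the average `C * 2 ^ J`. The factor `8 / 2 ^ J` in
`norm_le_of_tail_ge` cancels the dependence on `J`, which is the only place where the bound `M` on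
`z` enters. -/
lemma spaceG_subset_of_lintegral_le {C : ℝ≥0} (h : ∀ (n : ℕ) (a : ℕ → ℕ → ℝ),
    ∫⁻ u : I, X.norm (randomSum e a n u) ≤ C * l2NormUpTo a n) : spaceG ⊆ X.carrier := by
  have key : ∀ z : MeasFun, EssBounded z → expModular z 1 ≤ 1 →
      X.norm z ≤ 4 * X.norm 1 + 8 * C := by
    rintro z ⟨M, hM⟩ hz
    obtain ⟨J, hJ⟩ := pow_unbounded_of_one_lt M (one_lt_two (α := ℝ))
    obtain ⟨u, hu, hle⟩ := exists_notMem_null_le_lintegral (μ := (volume : Measure I))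
      (measurable_norm_randomSum X e rowCoeff (4 ^ J + 1)).aemeasurable
      (ae_iff.1 ae_abs_rademacher)
    simp only [Set.mem_ofPred_eq, not_not] at hu
    have h1 := hle.trans (h _ _)
    rw [l2NormUpTo_rowCoeff] at h1
    refine (norm_le_of_tail_ge X (J := J) (fun i hi => le_volume_rowSum e hu hi) hz ?_).trans ?_
    · filter_upwards [hM] with t ht
      have : (0 : ℝ) < 2 ^ J := by positivity
      linarith
    · refine add_le_add le_rfl ?_
      refine (mul_le_mul_right h1 _).trans (le_of_eq ?_)
      rw [ENNReal.ofReal_div_of_pos (by positivity), ENNReal.ofReal_pow (by norm_num),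
        ENNReal.ofReal_ofNat, ENNReal.ofReal_ofNat, mul_comm (C : ℝ≥0∞), ← mul_assoc,
        ENNReal.div_mul_cancel (by simp) (by simp)]
  have hfin : 4 * X.norm 1 + 8 * C ≠ ∞ := ENNReal.add_ne_top.2
    ⟨ENNReal.mul_ne_top (by norm_num) X.norm_one_lt_top.ne,
      ENNReal.mul_ne_top (by norm_num) ENNReal.coe_ne_top⟩
  refine X.spaceG_subset_of_norm_le (C := (4 * X.norm 1 + 8 * C).toNNReal) fun y l hy hl hyl => ?_
  rw [ENNReal.coe_toNNReal hfin]
  have h1 := key (l⁻¹ • y) (hy.smul _) (by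
    rw [expModular_smul _ (inv_pos.2 hl)]
    simpa using hyl)
  rw [X.norm_smul, abs_of_pos (inv_pos.2 hl), ENNReal.ofReal_inv_of_pos hl,
    ENNReal.inv_mul_le_iff (by simpa using hl) ENNReal.ofReal_ne_top] at h1
  rwa [mul_comm]

end Estimates

/-! ### Infinite sums -/

/-- The array `a` with the entries `a_{ij}`, `j < m`, replaced by zero. -/
def tailCoeff (a : ℕ → ℕ → ℝ) (m i j : ℕ) : ℝ := if j < m then 0 else a i j

/-- The array `a` with the entries `a_{ij}`, `m ≤ j`, replaced by zero. -/
def headCoeff (a : ℕ → ℕ → ℝ) (m i j : ℕ) : ℝ := if j < m then a i j else 0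

section Arrays

variable (e : ℕ → ℕ → ℕ) (a : ℕ → ℕ → ℝ) {m n : ℕ}

lemma randomSum_tailCoeff (h : m ≤ n) (u : I) :
    randomSum e (tailCoeff a m) n u = randomSum e a n u - randomSum e a m u := by
  induction n, h using Nat.le_induction with
  | base =>
    rw [sub_self]
    refine Finset.sum_eq_zero fun j hj => Finset.sum_eq_zero fun i _ => ?_
    rw [tailCoeff, if_pos (Finset.mem_range.1 hj), zero_mul, zero_smul]
  | succ n h ih =>
    have hs : ∀ b : ℕ → ℕ → ℝ, randomSum e b (n + 1) u = randomSum e b n u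
        + ∑ i ∈ Finset.range n, (b i n * rademacher (e i n) u) • chaosFun i n :=
      fun b => Finset.sum_range_succ _ _
    rw [hs, hs, ih]
    simp only [tailCoeff, if_neg (not_lt.2 h)]
    abel

lemma randomSum_headCoeff (h : m ≤ n) (u : I) :
    randomSum e (headCoeff a m) n u = randomSum e a m u := by
  unfold randomSum
  rw [← Finset.sum_subset (Finset.range_mono h)]
  · refine Finset.sum_congr rfl fun j hj => Finset.sum_congr rfl fun i _ => ?_
    rw [headCoeff, if_pos (Finset.mem_range.1 hj)]
  · intro j _ hj
    refine Finset.sum_eq_zero fun i _ => ?_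
    rw [headCoeff, if_neg fun hlt => hj (Finset.mem_range.2 hlt), zero_mul, zero_smul]

lemma l2Norm_headCoeff (m : ℕ) : l2Norm (headCoeff a m) = l2NormUpTo a m := by
  unfold l2Norm l2NormUpTo
  rw [tsum_eq_sum (s := Finset.range m)]
  · congr 1
    refine Finset.sum_congr rfl fun j hj => Finset.sum_congr rfl fun i _ => ?_
    rw [headCoeff, if_pos (Finset.mem_range.1 hj)]
  · intro j hj
    refine Finset.sum_eq_zero fun i _ => ?_
    rw [headCoeff, if_neg fun hlt => hj (Finset.mem_range.2 hlt)]
    simp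

lemma l2NormUpTo_le_l2Norm (n : ℕ) : l2NormUpTo a n ≤ l2Norm a :=
  ENNReal.rpow_le_rpow (ENNReal.sum_le_tsum _) (by norm_num)

lemma tendsto_l2NormUpTo : Tendsto (l2NormUpTo a) atTop (𝓝 (l2Norm a)) :=
  ((ENNReal.continuous_rpow_const (y := 1 / 2)).tendsto _).comp (ENNReal.tendsto_nat_tsum _)

lemma tendsto_l2Norm_tailCoeff (h : l2Norm a ≠ ∞) :
    Tendsto (fun m => l2Norm (tailCoeff a m)) atTop (𝓝 0) := by
  have h1 : ∑' j, ∑ i ∈ Finset.range j, ENNReal.ofReal (a i j ^ 2) ≠ ∞ := by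
    intro h1
    apply h
    rw [l2Norm, h1, ENNReal.top_rpow_of_pos (by norm_num)]
  have h2 := ENNReal.tendsto_sum_nat_add _ h1
  have h3 := ((ENNReal.continuous_rpow_const (y := 1 / 2)).tendsto 0).comp h2
  rw [ENNReal.zero_rpow_of_pos (by norm_num)] at h3
  refine h3.congr fun m => ?_
  unfold l2Norm
  simp only [Function.comp_apply]
  congr 1
  rw [← ENNReal.summable.sum_add_tsum_nat_add'
    (f := fun j => ∑ i ∈ Finset.range j, ENNReal.ofReal (tailCoeff a m i j ^ 2)) (k := m),
    Finset.sum_eq_zero fun j hj => Finset.sum_eq_zero fun i _ => by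
      rw [tailCoeff, if_pos (Finset.mem_range.1 hj)]; simp, zero_add]
  refine tsum_congr fun k => Finset.sum_congr rfl fun i _ => ?_
  rw [tailCoeff, if_neg (by omega)]

end Arrays

/-! ### Almost sure convergence and divergence of the infinite chaos -/

section Convergence

variable (X : SymmetricSpace) {e : ℕ → ℕ → ℕ}
  (a : ℕ → ℕ → ℝ)

lemma maximal_inequality_randomSum
    (he : Set.InjOn (fun p : ℕ × ℕ => e p.1 p.2) {p | p.1 < p.2}) (m n : ℕ) (ε : ℝ≥0∞) :
    ε * (volume : Measure I) {u | ∃ k, m ≤ k ∧ k ≤ n ∧ ε < X.norm (randomSum e a k u)}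
      ≤ ∫⁻ u : I, X.norm (randomSum e a n u) := by
  classical
  set M := maxIndex e n
  let A : Set (ℕ → ℝ) := {s | ∃ k, m ≤ k ∧ k ≤ n ∧ ε < X.norm (signSum e a k s)}
  let ψ : (ℕ → ℝ) → ℝ≥0∞ := A.indicator fun _ => ε
  have hdep : ∀ s s', (∀ k ≤ M, s k = s' k) → ψ s = ψ s' := by
    intro s s' h
    have : s ∈ A ↔ s' ∈ A := by
      refine exists_congr fun k => and_congr_right fun _ => and_congr_right fun hk => ?_
      rw [signSum_congr e a k fun l hl => h l (hl.trans (maxIndex_mono e hk))]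
    simp only [ψ, Set.indicator, this]
  have heven : ∀ s, ψ (-s) = ψ s := by
    intro s
    have : -s ∈ A ↔ s ∈ A := by
      simp only [A, Set.mem_ofPred_eq, signSum_neg, X.norm_neg]
    simp only [ψ, Set.indicator, this]
  have h1 := mul_meas_ge_le_lintegral (μ := (volume : Measure I))
    (measurable_comp_rademacher M ψ hdep) ε
  have h2 : {u : I | ∃ k, m ≤ k ∧ k ≤ n ∧ ε < X.norm (randomSum e a k u)}
      ⊆ {u : I | ε ≤ ψ fun k => rademacher k u} := by
    rintro u ⟨k, hk, hkn, h⟩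
    rw [randomSum_eq_signSum] at h
    have hm : (fun k => rademacher k u) ∈ A := ⟨k, hk, hkn, h⟩
    change ε ≤ A.indicator _ _
    rw [Set.indicator_of_mem hm]
  refine (mul_le_mul_right (measure_mono h2) _).trans (h1.trans ?_)
  rw [lintegral_rademacher_of_even M ψ heven hdep, lintegral_randomSum e a n le_rfl X.norm X.norm_neg]
  refine mul_le_mul_right ?_ _
  let idx : (Σ _ : ℕ, ℕ) → Fin (M + 1) := fun p => Fin.ofNat (M + 1) (e p.2 p.1)
  -- Multiplication by `η k` keeps the signs of the `k`-th partial sum and flips all others.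
  -- Injectivity of `e` keeps the two groups apart, so averaging the `n`-th sum with its reflection
  -- leaves the `k`-th.
  let η : ℕ → Fin (M + 1) → ℤˣ := fun k κ => if ∃ p ∈ pairsBelow k, idx p = κ then 1 else -1
  have hsame : ∀ k ω, ∀ p ∈ pairsBelow k,
      signSeq (η k * ω) (e p.2 p.1) = signSeq ω (e p.2 p.1) := by
    intro k ω p hp
    have : η k (idx p) = 1 := if_pos ⟨p, hp, rfl⟩
    simp only [signSeq, Pi.mul_apply]
    change sgn (η k (idx p) * ω (idx p)) = sgn (ω (idx p))
    rw [this, one_mul]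
  have hflip : ∀ k ω, ∀ p ∈ pairsBelow n, p ∉ pairsBelow k → k ≤ n →
      signSeq (η k * ω) (e p.2 p.1) = -signSeq ω (e p.2 p.1) := by
    intro k ω p hp hpk hk
    have : η k (idx p) = -1 := if_neg fun ⟨q, hq, hqp⟩ => hpk
      (injOn_pairsBelow n he le_rfl (pairsBelow_mono hk hq) hp hqp ▸ hq)
    simp only [signSeq, Pi.mul_apply]
    change sgn (η k (idx p) * ω (idx p)) = -sgn (ω (idx p))
    rw [this, neg_one_mul, sgn_neg]
  refine maximal_inequality (fun k ω => X.norm (signSum e a k (signSeq ω)))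
    (fun k => Equiv.mulLeft (η k)) m n ?_ ?_ ε
  · intro j k ω hjk
    have : signSum e a j (signSeq (η k * ω)) = signSum e a j (signSeq ω) :=
      Finset.sum_congr rfl fun p hp => by rw [hsame k ω p (pairsBelow_mono hjk hp)]
    simp only [Equiv.coe_mulLeft, this]
  · intro k ω hk
    have hsum : signSum e a n (signSeq ω) + signSum e a n (signSeq (η k * ω))
        = (2 : ℝ) • signSum e a k (signSeq ω) := by
      unfold signSum
      rw [← Finset.sum_add_distrib, Finset.smul_sum, ← Finset.sum_subset (pairsBelow_mono hk)]
      · refine Finset.sum_congr rfl fun p hp => ?_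
        rw [hsame k ω p hp, two_smul]
      · intro p hp hpk
        rw [hflip k ω p hp hpk hk, mul_neg, neg_smul, add_neg_cancel]
    have h3 := X.norm_add_le (signSum e a n (signSeq ω)) (signSum e a n (signSeq (η k * ω)))
    rw [hsum, X.norm_smul, abs_two, ENNReal.ofReal_ofNat] at h3
    exact h3

variable {a} {C : ℝ≥0}

lemma tendsto_mul_l2Norm_tailCoeff (ha : l2Norm a ≠ ∞) :
    Tendsto (fun m => (C : ℝ≥0∞) * l2Norm (tailCoeff a m)) atTop (𝓝 0) := by
  simpa using ENNReal.Tendsto.const_mul (a := (C : ℝ≥0∞)) (tendsto_l2Norm_tailCoeff a ha)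
    (Or.inr ENNReal.coe_ne_top)

/-- Almost sure convergence of the random chaos in `X`. -/
lemma ae_exists_tendsto_randomSum
    (he : Set.InjOn (fun p : ℕ × ℕ => e p.1 p.2) {p | p.1 < p.2})
    (hC : ∀ (n : ℕ) (a : ℕ → ℕ → ℝ),
      ∫⁻ u : I, X.norm (randomSum e a n u) ≤ C * l2NormUpTo a n) (ha : l2Norm a ≠ ∞) :
    ∀ᵐ u : I, ∃ x : MeasFun, Tendsto (fun n => X.norm (randomSum e a n u - x)) atTop (𝓝 0) := by
  have hbad : ∀ ε : ℝ≥0∞, ε ≠ 0 → ∀ᵐ u : I, ∃ m, ∀ k ≥ m,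
      X.norm (randomSum e a k u - randomSum e a m u) ≤ ε := by
    intro ε hε
    let B : ℕ → ℕ → Set I := fun m n =>
      {u | ∃ k, m ≤ k ∧ k ≤ n ∧ ε < X.norm (randomSum e (tailCoeff a m) k u)}
    -- The maximal inequality for the array cut below `m`, uniform in `n`; the right-hand side tends
    -- to 0 with the tail of `‖a‖₂`.
    have hB : ∀ m, ε * (volume : Measure I) (⋃ n, B m n) ≤ C * l2Norm (tailCoeff a m) := by
      intro m
      have hmono : Monotone (B m) := by
        rintro n n' hn u ⟨k, hk, hkn, h⟩
        exact ⟨k, hk, hkn.trans hn, h⟩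
      rw [hmono.measure_iUnion, ENNReal.mul_iSup]
      refine iSup_le fun n => ?_
      exact (maximal_inequality_randomSum X (tailCoeff a m) he m n ε).trans
        ((hC n _).trans (mul_le_mul_right (l2NormUpTo_le_l2Norm _ n) _))
    rw [ae_iff]
    set N := {u : I | ¬ ∃ m, ∀ k ≥ m, X.norm (randomSum e a k u - randomSum e a m u) ≤ ε}
    have hN : ∀ m, ε * (volume : Measure I) N ≤ C * l2Norm (tailCoeff a m) := by
      intro m
      refine (mul_le_mul_right (measure_mono fun u hu => ?_) _).trans (hB m)
      have hu' : ¬ ∃ m, ∀ k ≥ m, X.norm (randomSum e a k u - randomSum e a m u) ≤ ε := hu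
      push Not at hu'
      obtain ⟨k, hk, h⟩ := hu' m
      refine Set.mem_iUnion.2 ⟨k, k, hk, le_rfl, ?_⟩
      rwa [randomSum_tailCoeff e a hk]
    have h0 : ε * (volume : Measure I) N ≤ 0 := ge_of_tendsto' (tendsto_mul_l2Norm_tailCoeff ha) hN
    exact (mul_eq_zero.1 (le_antisymm h0 zero_le)).resolve_left hε
  have hall : ∀ᵐ u : I, ∀ j : ℕ, ∃ m, ∀ k ≥ m,
      X.norm (randomSum e a k u - randomSum e a m u) ≤ (j : ℝ≥0∞)⁻¹ :=
    ae_all_iff.2 fun j => hbad _ (ENNReal.inv_ne_zero.2 (ENNReal.natCast_ne_top j))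
  filter_upwards [hall] with u hu
  obtain ⟨x, _, hx⟩ := X.complete (fun n => randomSum e a n u)
    (fun n => by
      rw [randomSum_eq_signSum]
      obtain ⟨M, hM⟩ := essBounded_signSum e a n fun k => rademacher k u
      exact X.norm_lt_top_of_ae_bound hM)
    (fun ε hε => by
      obtain ⟨j, hj⟩ := ENNReal.exists_inv_nat_lt (ENNReal.half_pos hε.ne').ne'
      obtain ⟨m, hm⟩ := hu j
      refine ⟨m, fun k hk l hl => ?_⟩
      refine (X.norm_sub_le _ (randomSum e a m u) _).trans_lt ?_
      rw [X.norm_sub_comm (randomSum e a m u)]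
      exact (ENNReal.add_lt_add ((hm k hk).trans_lt hj) ((hm l hl).trans_lt hj)).trans_le
        (ENNReal.add_halves ε).le)
  exact ⟨x, hx⟩

/-- Almost sure convergence and lower semicontinuity of the norm put Fatou's lemma to work. -/
lemma lintegral_limNorm_le
    (he : Set.InjOn (fun p : ℕ × ℕ => e p.1 p.2) {p | p.1 < p.2})
    (hC : ∀ (n : ℕ) (a : ℕ → ℕ → ℝ),
      ∫⁻ u : I, X.norm (randomSum e a n u) ≤ C * l2NormUpTo a n) (ha : l2Norm a ≠ ∞) :
    ∫⁻ u : I, X.limNorm (fun n => randomSum e a n u) ≤ C * l2Norm a := by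
  calc ∫⁻ u : I, X.limNorm (fun n => randomSum e a n u)
      ≤ ∫⁻ u : I, liminf (fun n => X.norm (randomSum e a n u)) atTop := by
        refine lintegral_mono_ae ?_
        filter_upwards [ae_exists_tendsto_randomSum X he hC ha] with u ⟨x, hx⟩
        exact (iInf₂_le x hx).trans (X.norm_le_liminf hx)
    _ ≤ liminf (fun n => ∫⁻ u : I, X.norm (randomSum e a n u)) atTop :=
        lintegral_liminf_le fun n => measurable_norm_randomSum X e a n
    _ ≤ C * l2Norm a := by
        refine liminf_le_of_le (by isBoundedDefault) fun b hb => ?_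
        obtain ⟨n, hn⟩ := hb.exists
        exact hn.trans ((hC n a).trans (mul_le_mul_right (l2NormUpTo_le_l2Norm a n) _))

/-- The `m`-th partial sum is the limit minus the limit of the tails. The tail is majorized by the
liminf `g`, so only `g` has to be measurable. Where no limit exists the bound is trivial. -/
lemma le_lintegral_limNorm (hC : ∀ (n : ℕ) (a : ℕ → ℕ → ℝ),
      ∫⁻ u : I, X.norm (randomSum e a n u) ≤ C * l2NormUpTo a n)
    (hC' : ∀ n : ℕ, (C : ℝ≥0∞)⁻¹ * l2NormUpTo a n ≤ ∫⁻ u : I, X.norm (randomSum e a n u))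
    (hC0 : 0 < C) (ha : l2Norm a ≠ ∞) :
    (C : ℝ≥0∞)⁻¹ * l2Norm a ≤ ∫⁻ u : I, X.limNorm (fun n => randomSum e a n u) := by
  have key : ∀ m, (C : ℝ≥0∞)⁻¹ * l2NormUpTo a m
      ≤ (∫⁻ u : I, X.limNorm (fun n => randomSum e a n u)) + C * l2Norm (tailCoeff a m) := by
    intro m
    have hmeas : ∀ n, Measurable fun u : I => X.norm (randomSum e (tailCoeff a m) n u) :=
      fun n => measurable_norm_randomSum X e _ n
    let g : I → ℝ≥0∞ := fun u => liminf (fun n => X.norm (randomSum e (tailCoeff a m) n u)) atTop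
    have hg : Measurable g := Measurable.liminf hmeas
    have hpt : ∀ u, X.norm (randomSum e a m u)
        ≤ X.limNorm (fun n => randomSum e a n u) + g u := by
      intro u
      rw [← tsub_le_iff_right]
      refine le_iInf₂ fun x hx => ?_
      rw [tsub_le_iff_right]
      refine (X.norm_le_add _ x).trans (add_le_add le_rfl ?_)
      rw [X.norm_sub_comm]
      have h1 : Tendsto (fun n => X.norm (randomSum e (tailCoeff a m) n u
          - (x - randomSum e a m u))) atTop (𝓝 0) := by
        refine hx.congr' ?_
        filter_upwards [eventually_ge_atTop m] with n hn
        rw [randomSum_tailCoeff e a hn, sub_sub_sub_cancel_right]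
      exact X.norm_le_liminf h1
    have hgint : ∫⁻ u, g u ≤ C * l2Norm (tailCoeff a m) := by
      refine (lintegral_liminf_le hmeas).trans ?_
      refine liminf_le_of_le (by isBoundedDefault) fun b hb => ?_
      obtain ⟨n, hn⟩ := hb.exists
      exact hn.trans ((hC n _).trans (mul_le_mul_right (l2NormUpTo_le_l2Norm _ n) _))
    calc (C : ℝ≥0∞)⁻¹ * l2NormUpTo a m ≤ ∫⁻ u : I, X.norm (randomSum e a m u) := hC' m
      _ ≤ ∫⁻ u : I, (X.limNorm (fun n => randomSum e a n u) + g u) := lintegral_mono hpt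
      _ = (∫⁻ u : I, X.limNorm (fun n => randomSum e a n u)) + ∫⁻ u, g u :=
          lintegral_add_right _ hg
      _ ≤ _ := by gcongr
  have h1 : Tendsto (fun m => (C : ℝ≥0∞)⁻¹ * l2NormUpTo a m) atTop
      (𝓝 ((C : ℝ≥0∞)⁻¹ * l2Norm a)) :=
    ENNReal.Tendsto.const_mul (tendsto_l2NormUpTo a)
      (Or.inr (ENNReal.inv_ne_top.2 (by exact_mod_cast hC0.ne')))
  have h2 := (tendsto_const_nhds (x := ∫⁻ u : I, X.limNorm (fun n => randomSum e a n u))).add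
    (tendsto_mul_l2Norm_tailCoeff (C := C) ha)
  rw [add_zero] at h2
  exact le_of_tendsto_of_tendsto' h1 h2 key

/-- Events of probability at least `3/32` occur infinitely often with at least that probability.
There the partial sums have norms unbounded along a subsequence, hence no limit of finite norm. -/
lemma lintegral_limNorm_eq_top
    (he : Set.InjOn (fun p : ℕ × ℕ => e p.1 p.2) {p | p.1 < p.2}) (ha : l2Norm a = ∞) :
    ∫⁻ u : I, X.limNorm (fun n => randomSum e a n u) = ∞ := by
  set c : ℝ≥0∞ := ENNReal.ofReal (3 / 128) * X.norm 1
  have hc : c ≠ 0 := mul_ne_zero (by simp) X.norm_one_ne_zero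
  let B : ℕ → Set I := fun n => {u | c * l2NormUpTo a n ≤ 2 * X.norm (randomSum e a n u)}
  have hBm : ∀ n, MeasurableSet (B n) := fun n =>
    measurableSet_le measurable_const ((measurable_norm_randomSum X e a n).const_mul 2)
  have hB : ∀ n, ENNReal.ofReal (3 / 32) ≤ (volume : Measure I) (B n) := by
    intro n
    simp only [B, l2NormUpTo_eq]
    set V := ∑ p ∈ pairsBelow n, a p.2 p.1 ^ 2
    have hV : 0 ≤ V := Finset.sum_nonneg fun _ _ => sq_nonneg _
    rcases hV.eq_or_lt with h0 | h0
    · rw [← h0]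
      simp
      norm_num
    · refine (le_volume_norm_randomSum a n X he (Real.sqrt_pos.2 h0)
        (Real.sq_sqrt hV).symm).trans (measure_mono fun u hu => ?_)
      refine (le_of_eq ?_ : c * ENNReal.ofReal √V ≤ _).trans hu
      simp only [c]
      rw [mul_right_comm, ← ENNReal.ofReal_mul (by norm_num), ← ENNReal.ofReal_mul (by positivity)]
      congr 2
      ring
  let D : ℕ → Set I := fun N => ⋃ n ≥ N, B n
  have hDm : ∀ N, MeasurableSet (D N) := fun N =>
    MeasurableSet.iUnion fun n => MeasurableSet.iUnion fun _ => hBm n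
  have hDanti : Antitone D := fun N N' h u hu => by
    simp only [D, Set.mem_iUnion] at hu ⊢
    obtain ⟨n, hn, hu⟩ := hu
    exact ⟨n, h.trans hn, hu⟩
  have hvol : ENNReal.ofReal (3 / 32) ≤ (volume : Measure I) (⋂ N, D N) :=
    ge_of_tendsto' (tendsto_measure_iInter_atTop (fun N => (hDm N).nullMeasurableSet) hDanti
      ⟨0, measure_ne_top _ _⟩)
      fun N => (hB N).trans (measure_mono fun u hu => Set.mem_iUnion₂.2 ⟨N, le_rfl, hu⟩)
  have hKlim : Tendsto (fun n => c * l2NormUpTo a n) atTop (𝓝 ∞) := by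
    have h1 := ENNReal.Tendsto.const_mul (a := c) (tendsto_l2NormUpTo a)
      (Or.inl (by rw [ha]; exact ENNReal.top_ne_zero))
    rwa [ha, ENNReal.mul_top hc] at h1
  have hinf : ∀ u ∈ ⋂ N, D N, X.limNorm (fun n => randomSum e a n u) = ∞ := by
    intro u hu
    rw [SymmetricSpace.limNorm, iInf₂_eq_top]
    intro x hx
    by_contra hne
    have hL : 2 * (X.norm x + 1) < ∞ := ENNReal.mul_lt_top (by norm_num)
      (ENNReal.add_lt_top.2 ⟨lt_top_iff_ne_top.2 hne, by norm_num⟩)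
    obtain ⟨N, hN⟩ := eventually_atTop.1 ((hx.eventually (gt_mem_nhds one_pos)).and
      (hKlim.eventually (lt_mem_nhds hL)))
    have hu' := Set.mem_iInter.1 hu N
    simp only [D, Set.mem_iUnion] at hu'
    obtain ⟨n, hn, hun⟩ := hu'
    obtain ⟨h1, h2⟩ := hN n hn
    have h3 : X.norm (randomSum e a n u) ≤ X.norm x + 1 :=
      (X.norm_le_add _ x).trans (add_le_add le_rfl h1.le)
    exact absurd (h2.trans_le (hun.trans (mul_le_mul_right h3 2))) (lt_irrefl _)
  have h1 : ∫⁻ u : I, (⋂ N, D N).indicator (fun _ => ∞) u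
      ≤ ∫⁻ u : I, X.limNorm (fun n => randomSum e a n u) := by
    refine lintegral_mono fun u => Set.indicator_apply_le' (fun hu => (hinf u hu).ge)
      fun _ => zero_le
  rw [lintegral_indicator_const (MeasurableSet.iInter hDm), ENNReal.top_mul] at h1
  · exact top_le_iff.1 h1
  · intro h0
    rw [h0] at hvol
    exact absurd hvol (by simp)

end Convergence

theorem corollary2 (X : SymmetricSpace) (e : ℕ → ℕ → ℕ)
    (he : Set.InjOn (fun p : ℕ × ℕ => e p.1 p.2) {p | p.1 < p.2}) :
    List.TFAE [
      -- `X ⊃ G`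
      spaceG ⊆ X.carrier,
      -- the two-sided estimate for all finite sums
      ∃ C : ℝ≥0, 0 < C ∧ ∀ (n : ℕ) (a : ℕ → ℕ → ℝ),
        (C : ℝ≥0∞)⁻¹ * l2NormUpTo a n ≤ ∫⁻ u : I, X.norm (randomSum e a n u) ∧
        ∫⁻ u : I, X.norm (randomSum e a n u) ≤ C * l2NormUpTo a n,
      -- the two-sided estimate for all infinite sums
      ∃ C : ℝ≥0, 0 < C ∧ ∀ a : ℕ → ℕ → ℝ,
        (C : ℝ≥0∞)⁻¹ * l2Norm a ≤ ∫⁻ u : I, X.limNorm (fun n => randomSum e a n u) ∧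
        ∫⁻ u : I, X.limNorm (fun n => randomSum e a n u) ≤ C * l2Norm a] := by
  tfae_have 1 → 2 := by
    intro h
    obtain ⟨C, hC⟩ := X.exists_norm_le_of_spaceG_subset h
    set c : ℝ≥0∞ := ENNReal.ofReal (9 / 8192) * X.norm 1
    have hc : c ≠ 0 := mul_ne_zero (by simp) X.norm_one_ne_zero
    have hc' : c⁻¹ ≠ ∞ := ENNReal.inv_ne_top.2 hc
    -- One constant above both `6 * C` and `c⁻¹`; the summand 1 secures positivity.
    refine ⟨6 * C + c⁻¹.toNNReal + 1, by positivity, fun n a => ⟨?_, ?_⟩⟩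
    · refine le_trans (mul_le_mul_left ?_ _) (mul_l2NormUpTo_le_lintegral X he a n)
      rw [ENNReal.inv_le_iff_inv_le]
      push_cast
      rw [ENNReal.coe_toNNReal hc']
      exact le_add_right (le_add_left le_rfl)
    · refine (lintegral_norm_randomSum_le X he hC a n).trans (mul_le_mul_left ?_ _)
      push_cast
      exact le_add_right (le_add_right le_rfl)
  tfae_have 2 → 1 := by
    rintro ⟨C, _, hC⟩
    exact spaceG_subset_of_lintegral_le X fun n a => (hC n a).2
  tfae_have 2 → 3 := by
    rintro ⟨C, hC0, hC⟩
    refine ⟨C, hC0, fun a => ?_⟩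
    rcases eq_or_ne (l2Norm a) ∞ with ha | ha
    · rw [lintegral_limNorm_eq_top X he ha, ha]
      exact ⟨le_top, by rw [ENNReal.mul_top (by exact_mod_cast hC0.ne')]⟩
    · exact ⟨le_lintegral_limNorm X (fun n a => (hC n a).2) (fun n => (hC n a).1) hC0 ha,
        lintegral_limNorm_le X he (fun n a => (hC n a).2) ha⟩
  tfae_have 3 → 2 := by
    rintro ⟨C, hC0, hC⟩
    refine ⟨C, hC0, fun n a => ?_⟩
    -- The partial sums of the truncated array are constant from index `n` on, so the infinite sum
    -- is the finite one.
    have h := hC (headCoeff a n)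
    have hlim : ∀ u : I, X.limNorm (fun k => randomSum e (headCoeff a n) k u)
        = X.norm (randomSum e a n u) :=
      fun u => X.limNorm_eq_norm fun k hk => randomSum_headCoeff e a hk u
    simp only [hlim, l2Norm_headCoeff] at h
    exact h
  tfae_finish
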